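/- **Setting.** Let $K$ independent data streams be given. Stream $k\in[K]=\{1,\dots,K\}$ is $X_k=(X_k(n))_{n\ge1}$, and its law is $\mathrm P_{k,\theta}$ for an unknown $\theta$ in a subset $\Theta_k$ of a Euclidean space; $\Theta_k^0,\Theta_k^1$ are disjoint non-empty subsets of $\Theta_k$, and the stream is a *signal* if $\theta\in\Theta_k^1$ and *noise* if $\theta\in\Theta_k^0$. Put $\mathcal F_k(n)=\sigma(X_k(1),\dots,X_k(n))$ and $\mathcal F(n)=\sigma(\mathcal F_1(n),\dots,\mathcal F_K(n))$. For $A\subseteq[K]$ let $\boldsymbol\Theta_A$ be the set of $\boldsymbol\theta=(\theta_1,\dots,\theta_K)$ with $\theta_i\in\Theta_i^1$ for $i\in A$ and $\theta_j\in\Theta_j^0$ for $j\notin A$, let $\mathrm P_{A,\boldsymbol\theta}=\mathrm P_{1,\theta_1}\otimes\cdots\otimes\mathrm P_{K,\theta_K}$, and let $\mathrm E_{A,\boldsymbol\theta}$ be the expectation. Let $\Pi$ be a class of subsets of $[K]$ such that for each $k$ there are $A,B\in\Pi$ with $k\in A$ and $k\notin B$. **Likelihoods.** The law of $(X_k(1),\dots,X_k(n))$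 under $\mathrm P_{k,\theta}$ has density $e^{\ell_k(n,\theta)}$, with $\ell_k(n,\theta)$ real-valued, with respect to a $\sigma$-finite measure $\nu_{k,n}$ that does not depend on $\theta$ and satisfies $\nu_{k,n+1}(dh,dz)=\nu_{k,n}(dh)\,\kappa_{k,n}(h,dz)$ for a kernel $\kappa_{k,n}$; $\ell_k(0,\theta)=0$. The versions are jointly measurable in the parameter and the sample, and for $\nu_{k,n}$-almost every $h$ one has $\int e^{\ell_k(n+1,\theta)(h,z)}\,\kappa_{k,n}(h,dz)=e^{\ell_k(n,\theta)(h)}$ simultaneously for all $\theta\in\Theta_k$. For $i\in\{0,1\}$ let $\ell_k^i(n)=\sup_{\theta\in\Theta_k^i}\ell_k(n,\theta)$, assumed measurable. Let $\hat\theta_k(n)$, $n\ge0$, be $\Theta_k$-valued and $\mathcal F_k(n)$-measurable ($\hat\theta_k(0)$ deterministic), and set $\ell_k^*(0)=0$, $\ell^*_k(n)=\ell^*_k(n-1)+\ell_k(n,\hat\theta_k(n-1))-\ell_k(n-1,\hat\theta_k(n-1))$. The adaptive log-likelihood ratio is $$\lambda_k^*(n)=\begin{cases}\ell_k^*(n)-\ell_k^0(n)&\text{if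 }\ell_k^0(n)<\min\{\ell_k^1(n),\ell_k^*(n)\},\\ \ell_k^1(n)-\ell_k^*(n)&\text{if }\ell_k^1(n)<\min\{\ell_k^0(n),\ell_k^*(n)\},\\0&\text{otherwise.}\end{cases}$$ **Procedures.** A sequential procedure $\chi=(\mathbf T,\mathbf D)$ consists of $\{\mathcal F(n)\}$-stopping times $T_k\geq 1$ and $\mathcal F(T_k)$-measurable decisions $D_k\in\{0,1\}$, $k\in[K]$; write $\mathbf D$ also for $\{k:D_k=1\}$. It belongs to the class $\Delta'$ of decentralized procedures if moreover, for every $k$, $T_k$ is an $\{\mathcal F_k(n)\}$-stopping time and $D_k$ is $\mathcal F_k(T_k)$-measurable. For $\alpha,\beta\in(0,1)$, $\Delta^*(\alpha,\beta,\Pi)$ is the class of sequential procedures such that, for all $A\in\Pi$, all $T_k$ are $\mathrm P_{A,\boldsymbol\theta}$-a.s. finite for every $\boldsymbol\theta\in\boldsymbol\Theta_A$, $\sup_{\boldsymbol\theta\in\boldsymbol\Theta_A}\mathrm P_{A,\boldsymbol\theta}(\mathbf D\setminus A\ne\emptyset)\le\alpha$ and $\sup_{\boldsymbol\theta\in\boldsymbol\Theta_A}\mathrm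 P_{A,\boldsymbol\theta}(A\setminus\mathbf D\ne\emptyset)\le\beta$. The parallel SPRT $\tilde\chi$ with thresholds $a,b>0$ is $\tilde T_k=\inf\{n\ge1:\lambda_k^*(n)\notin(-b,a)\}$, $\tilde D_k=\mathbf 1\{\lambda_k^*(\tilde T_k)\ge a\}$. **Assumptions.** For every $k$ and $\theta,u\in\Theta_k$ there is a number $I_k(\theta,u)>0$ with $\mathrm P_{k,\theta}\big(\limsup_n\frac{\ell_k(n,\theta)-\ell_k(n,u)}n\le I_k(\theta,u)\big)=1$; one has $I_k(\theta):=\inf_{u\in\Theta_k^0}I_k(\theta,u)>0$ for $\theta\in\Theta_k^1$ and $J_k(\theta):=\inf_{u\in\Theta_k^1}I_k(\theta,u)>0$ for $\theta\in\Theta_k^0$; and for every $\epsilon>0$ $$\sum_{n\ge1}\mathrm P_{k,\theta}\Big(\tfrac{\ell_k^*(n)-\ell_k^0(n)}n\le I_k(\theta)-\epsilon\Big)<\infty\ (\theta\in\Theta_k^1),\qquad \sum_{n\ge1}\mathrm P_{k,\theta}\Big(\tfrac{\ell_k^*(n)-\ell_k^1(n)}n\le J_k(\theta)-\epsilon\Big)<\infty\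 (\theta\in\Theta_k^0).$$ **Theorem 7.2.** Suppose that the thresholds $a=a(\alpha,\beta)>0$ and $b=b(\alpha,\beta)>0$ are such that $\tilde\chi\in\Delta^*(\alpha,\beta,\Pi)$ for all $\alpha,\beta\in(0,1)$ and $a\sim|\log\alpha|$, $b\sim|\log\beta|$ as $\alpha,\beta\to0$. Then, as $\alpha,\beta\to0$, $$\mathrm E_{A,\boldsymbol\theta}[\tilde T_i]\sim\inf\{\mathrm E_{A,\boldsymbol\theta}[T_i]:\chi\in\Delta'\cap\Delta^*(\alpha,\beta,\Pi)\}\sim\frac{|\log\alpha|}{I_i(\theta_i)},$$ $$\mathrm E_{A,\boldsymbol\theta}[\tilde T_j]\sim\inf\{\mathrm E_{A,\boldsymbol\theta}[T_j]:\chi\in\Delta'\cap\Delta^*(\alpha,\beta,\Pi)\}\sim\frac{|\log\beta|}{J_j(\theta_j)},$$ for every $A\in\Pi$, $i\in A$, $j\notin A$ and $\boldsymbol\theta\in\boldsymbol\Theta_A$. Moreover, the thresholds $a=|\log\alpha|+\max_{A\in\Pi}\log|A^c|$ and $b=|\log\beta|+\max_{A\in\Pi}\log|A|$ satisfy these requirements.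 -/

import Mathlib

open MeasureTheory ProbabilityTheory Filter Topology
open scoped ENNReal

namespace SeqTest

/-- The first `n` entries of an infinite sequence of observations. Entry `t` of the sequence is the
`(t+1)`-st observation, so this is the sample available at time `n`. -/
def pre {X : Type*} (n : ℕ) (x : ℕ → X) : Fin n → X := fun t => x t

/-- One data stream with observations in `X`: a parametric family of laws of the whole stream,
indexed by a subset of a Euclidean space, two composite hypotheses, and the log-likelihood function.

`ref n` is a sigma-finite measure on samples of size `n` that dominates all the laws, and
`exp (loglik n θ)` is a version of the density of the first `n` observations. As the
log-likelihood gets maximized over `θ` and evaluated at random `θ`, versions have to be fixed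
(jointly measurably in parameter and sample): for each single `θ` the identity in `loglik_step`
holds almost everywhere anyway, and the field asks that the exceptional set does not depend
on `θ`. -/
structure DataStream (X : Type*) [MeasurableSpace X] where
  /-- dimension of the Euclidean space that contains the parameters -/
  dim : ℕ
  /-- the parameter space -/
  param : Set (EuclideanSpace ℝ (Fin dim))
  /-- the parameters of the null hypothesis -/
  null : Set param
  /-- the parameters of the alternative hypothesis -/
  alt : Set param
  null_nonempty : null.Nonempty
  alt_nonempty : alt.Nonempty
  disjoint : Disjoint null alt
  /-- the distribution of the stream -/
  law : param → Measure (ℕ → X)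
  law_prob : ∀ θ, IsProbabilityMeasure (law θ)
  /-- the dominating measure for samples of size `n` -/
  ref : (n : ℕ) → Measure (Fin n → X)
  ref_sigmaFinite : ∀ n, SigmaFinite (ref n)
  /-- the dominating measure for the next observation given the first `n` observations -/
  refStep : (n : ℕ) → Kernel (Fin n → X) X
  refStep_sFinite : ∀ n, IsSFiniteKernel (refStep n)
  ref_succ : ∀ n, ref (n + 1) =
    (ref n ⊗ₘ refStep n).map
      (fun p : (Fin n → X) × X => (Fin.snoc (α := fun _ => X) p.1 p.2 : Fin (n + 1) → X))
  /-- the log-likelihood of a sample of size `n` -/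
  loglik : (n : ℕ) → param → (Fin n → X) → ℝ
  loglik_zero : ∀ θ h, loglik 0 θ h = 0
  loglik_measurable : ∀ n, Measurable (fun p : param × (Fin n → X) => loglik n p.1 p.2)
  loglik_density : ∀ n θ, (law θ).map (pre n) =
    (ref n).withDensity (fun h => ENNReal.ofReal (Real.exp (loglik n θ h)))
  loglik_step : ∀ n, ∀ᵐ h ∂ref n, ∀ θ,
    ∫⁻ z, ENNReal.ofReal (Real.exp (loglik (n + 1) θ (Fin.snoc (α := fun _ => X) h z)))
        ∂(refStep n h) =
      ENNReal.ofReal (Real.exp (loglik n θ h))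
  /-- the two maximum log-likelihoods are random variables -/
  sup_null_measurable :
    ∀ n, Measurable (fun h : Fin n → X => ⨆ θ ∈ null, (loglik n θ h : EReal))
  sup_alt_measurable :
    ∀ n, Measurable (fun h : Fin n → X => ⨆ θ ∈ alt, (loglik n θ h : EReal))

/-- Estimators `est n` of the parameter of a stream, each a function of the first `n` observations
of that same stream; `est 0` is a deterministic parameter. -/
structure Estimator {X : Type*} [MeasurableSpace X] (S : DataStream X) where
  est : (n : ℕ) → (Fin n → X) → S.param
  est_measurable : ∀ n, Measurable (est n)

namespace DataStream

variable {X : Type*} [MeasurableSpace X] (S : DataStream X)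

/-- The maximum log-likelihood at time `n` under the null hypothesis. -/
noncomputable def maxNull (n : ℕ) (x : ℕ → X) : EReal :=
  ⨆ θ ∈ S.null, (S.loglik n θ (pre n x) : EReal)

/-- The maximum log-likelihood at time `n` under the alternative hypothesis. -/
noncomputable def maxAlt (n : ℕ) (x : ℕ → X) : EReal :=
  ⨆ θ ∈ S.alt, (S.loglik n θ (pre n x) : EReal)

/-- The adaptive log-likelihood. -/
noncomputable def adaptive (E : Estimator S) : ℕ → (ℕ → X) → ℝ
  | 0, _ => 0
  | n + 1, x => adaptive E n x +
      (S.loglik (n + 1) (E.est n (pre n x)) (pre (n + 1) x) -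
        S.loglik n (E.est n (pre n x)) (pre n x))

/-- The adaptive log-likelihood ratio. -/
noncomputable def adaptiveLLR (E : Estimator S) (n : ℕ) (x : ℕ → X) : EReal :=
  if S.maxNull n x < min (S.maxAlt n x) (S.adaptive E n x : EReal) then
    (S.adaptive E n x : EReal) - S.maxNull n x
  else if S.maxAlt n x < min (S.maxNull n x) (S.adaptive E n x : EReal) then
    S.maxAlt n x - (S.adaptive E n x : EReal)
  else 0

/-- The numbers `I θ u` are positive and bound the growth rate of the log-likelihood ratio of `θ`
against `u` when `θ` is the true parameter. -/
def RateBound (I : S.param → S.param → ℝ) : Prop :=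
  ∀ θ u, 0 < I θ u ∧
    ∀ᵐ x ∂(S.law θ),
      limsup (fun n : ℕ =>
        (((S.loglik n θ (pre n x) - S.loglik n u (pre n x)) / (n : ℝ) : ℝ) : EReal)) atTop
        ≤ (I θ u : EReal)

/-- The smallest rate of `θ` against the null hypothesis. -/
noncomputable def rateNull (I : S.param → S.param → ℝ) (θ : S.param) : ℝ :=
  ⨅ u : S.null, I θ u

/-- The smallest rate of `θ` against the alternative hypothesis. -/
noncomputable def rateAlt (I : S.param → S.param → ℝ) (θ : S.param) : ℝ :=
  ⨅ u : S.alt, I θ u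

/-- The two hypotheses are separated. -/
def Separated (I : S.param → S.param → ℝ) : Prop :=
  (∀ θ ∈ S.alt, 0 < S.rateNull I θ) ∧ (∀ θ ∈ S.null, 0 < S.rateAlt I θ)

/-- One-sided complete convergence of the normalized adaptive statistics. The summation index `n`
stands for time `n + 1`. -/
def CompleteConvergence (E : Estimator S) (I : S.param → S.param → ℝ) : Prop :=
  (∀ θ ∈ S.alt, ∀ ε : ℝ, 0 < ε →
    ∑' n : ℕ, S.law θ {x | ((S.adaptive E (n + 1) x : EReal) - S.maxNull (n + 1) x) /
      ((n + 1 : ℕ) : EReal) ≤ ((S.rateNull I θ - ε : ℝ) : EReal)} < ∞) ∧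
  (∀ θ ∈ S.null, ∀ ε : ℝ, 0 < ε →
    ∑' n : ℕ, S.law θ {x | ((S.adaptive E (n + 1) x : EReal) - S.maxAlt (n + 1) x) /
      ((n + 1 : ℕ) : EReal) ≤ ((S.rateAlt I θ - ε : ℝ) : EReal)} < ∞)

end DataStream

section Multiple

variable {K : ℕ} {X : Fin K → Type*} [∀ k, MeasurableSpace (X k)]

/-- The sigma-algebra generated by the first `n` observations of stream `k`. -/
@[reducible] def streamSigma (X : Fin K → Type*) [∀ k, MeasurableSpace (X k)] (k : Fin K) (n : ℕ) :
    MeasurableSpace (∀ k, ℕ → X k) :=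
  ⨆ t : Fin n, MeasurableSpace.comap (fun ω : ∀ k, ℕ → X k => ω k t) inferInstance

/-- The sigma-algebra generated by the first `n` observations of all streams. -/
@[reducible] def allSigma (X : Fin K → Type*) [∀ k, MeasurableSpace (X k)] (n : ℕ) :
    MeasurableSpace (∀ k, ℕ → X k) :=
  ⨆ k : Fin K, streamSigma X k n

/-- Decision times and decisions, one for each stream, as functions of all the observations;
`dec k ω` means that stream `k` is identified as a signal. -/
structure Procedure (X : Fin K → Type*) where
  time : Fin K → (∀ k, ℕ → X k) → ℕ∞
  dec : Fin K → (∀ k, ℕ → X k) → Prop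

/-- The decision times are positive stopping times, and each decision is known at its decision
time, where the information at time `n` is `F k n` for the decision in stream `k`. -/
def Procedure.AdaptedTo (χ : Procedure X) (F : Fin K → ℕ → MeasurableSpace (∀ k, ℕ → X k)) :
    Prop :=
  ∀ k, (∀ ω, 1 ≤ χ.time k ω) ∧ MeasurableSet {ω | χ.dec k ω} ∧
    ∀ n : ℕ, MeasurableSet[F k n] {ω | χ.time k ω = n} ∧
      MeasurableSet[F k n] {ω | χ.time k ω = n ∧ χ.dec k ω} ∧
      MeasurableSet[F k n] {ω | χ.time k ω = n ∧ ¬ χ.dec k ω}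

/-- The family of all sequential multiple testing procedures. -/
def sequential (X : Fin K → Type*) [∀ k, MeasurableSpace (X k)] : Set (Procedure X) :=
  {χ | χ.AdaptedTo (fun _ n => allSigma X n)}

/-- The subfamily of decentralized procedures. -/
def decentralized (X : Fin K → Type*) [∀ k, MeasurableSpace (X k)] : Set (Procedure X) :=
  {χ | χ ∈ sequential X ∧ χ.AdaptedTo (fun k n => streamSigma X k n)}

/-- The parameters that are consistent with the subset of signals being `A`. -/
def consistent (S : ∀ k, DataStream (X k)) (A : Finset (Fin K)) : Set (∀ k, (S k).param) :=
  {θ | (∀ i ∈ A, θ i ∈ (S i).alt) ∧ ∀ j ∉ A, θ j ∈ (S j).null}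

/-- The joint distribution of the independent streams. -/
noncomputable def jointLaw (S : ∀ k, DataStream (X k)) (θ : ∀ k, (S k).param) :
    Measure (∀ k, ℕ → X k) :=
  Measure.pi (fun k => (S k).law (θ k))

/-- The expected decision time in stream `k`. -/
noncomputable def expTime (S : ∀ k, DataStream (X k)) (θ : ∀ k, (S k).param) (χ : Procedure X)
    (k : Fin K) : ℝ≥0∞ :=
  ∫⁻ ω, (χ.time k ω : ℝ≥0∞) ∂(jointLaw S θ)

/-- The sequential procedures that terminate almost surely and whose worst-case type-I and type-II
familywise error rates are at most `α` and `β` for every subset of signals in `prior`. -/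
def controlled (S : ∀ k, DataStream (X k)) (prior : Set (Finset (Fin K))) (α β : ℝ) :
    Set (Procedure X) :=
  {χ | χ ∈ sequential X ∧ ∀ A ∈ prior,
    (∀ θ ∈ consistent S A, ∀ k, ∀ᵐ ω ∂(jointLaw S θ), χ.time k ω < ⊤) ∧
    (⨆ θ ∈ consistent S A, jointLaw S θ {ω | ∃ j, j ∉ A ∧ χ.dec j ω}) ≤ ENNReal.ofReal α ∧
    (⨆ θ ∈ consistent S A, jointLaw S θ {ω | ∃ i, i ∈ A ∧ ¬ χ.dec i ω}) ≤ ENNReal.ofReal β}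

/-- The optimal expected decision time in stream `k` among decentralized procedures. -/
noncomputable def optTime (S : ∀ k, DataStream (X k)) (prior : Set (Finset (Fin K)))
    (θ : ∀ k, (S k).param) (k : Fin K) (α β : ℝ) : ℝ≥0∞ :=
  ⨅ χ ∈ decentralized X ∩ controlled S prior α β, expTime S θ χ k

/-- The first time `n ≥ 1` at which the adaptive log-likelihood ratio is outside `(-b, a)`. -/
noncomputable def sprtTime (S : ∀ k, DataStream (X k)) (E : ∀ k, Estimator (S k)) (a b : ℝ)
    (k : Fin K) (ω : ∀ k, ℕ → X k) : ℕ∞ :=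
  ⨅ (n : ℕ) (_ : 1 ≤ n ∧
    (S k).adaptiveLLR (E k) n (ω k) ∉ Set.Ioo ((-b : ℝ) : EReal) (a : EReal)), (n : ℕ∞)

/-- The parallel sequential probability ratio test with thresholds `a` and `b`, based on the
adaptive log-likelihood ratios: stream `k` is identified as a signal when its statistic is at
least `a` at the decision time. -/
noncomputable def sprt (S : ∀ k, DataStream (X k)) (E : ∀ k, Estimator (S k)) (a b : ℝ) :
    Procedure X where
  time := sprtTime S E a b
  dec k ω := ∃ n : ℕ, sprtTime S E a b k ω = n ∧
    (a : EReal) ≤ (S k).adaptiveLLR (E k) n (ω k)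

/-- Both error levels tend to zero, without any restriction on their relative speed. -/
def levels : Filter (ℝ × ℝ) := 𝓝[>] 0 ×ˢ 𝓝[>] 0

/-- `f ∼ g` as both error levels tend to zero. -/
def AsympEq (f g : ℝ → ℝ → ℝ≥0∞) : Prop :=
  Tendsto (fun p : ℝ × ℝ => f p.1 p.2 / g p.1 p.2) levels (𝓝 1)

/-- The thresholds are positive, the parallel test controls the error rates for all levels in
`(0, 1)`, and `a ∼ |log α|`, `b ∼ |log β|` as the levels tend to zero. -/
def SuitableThresholds (S : ∀ k, DataStream (X k)) (E : ∀ k, Estimator (S k))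
    (prior : Set (Finset (Fin K))) (a b : ℝ → ℝ → ℝ) : Prop :=
  (∀ α ∈ Set.Ioo (0 : ℝ) 1, ∀ β ∈ Set.Ioo (0 : ℝ) 1,
    0 < a α β ∧ 0 < b α β ∧ sprt S E (a α β) (b α β) ∈ controlled S prior α β) ∧
  Tendsto (fun p : ℝ × ℝ => a p.1 p.2 / |Real.log p.1|) levels (𝓝 1) ∧
  Tendsto (fun p : ℝ × ℝ => b p.1 p.2 / |Real.log p.2|) levels (𝓝 1)

end Multiple

end SeqTest

/-!
The adaptive log-likelihood predicts each observation with the parameter estimated from the previous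
ones, so its exponential is the density of a consistent family of laws, and Ville's inequality
bounds by `exp (-a)` the probability that it ever exceeds the true log-likelihood by `a`. This gives
the error bounds `exp (-a)` and `exp (-b)` for each stream, and the thresholds follow by a union
bound over the streams. Complete convergence moreover makes the probability that stream `k` has not
been decided correctly at a time `n ≥ a / s` summable for each `s` below the rate, so that the mean
decision time is at most `a / s + O(1)`.

For the lower bound, compare the true parameter `θ` of a signal with a noise parameter `u` whose
rate is close to the infimum. By time `m` the log-likelihood ratio of `θ` against `u` is at most
`m * C`, for each `C` above the rate, up to an event of vanishing probability. A decentralized test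
that stops by time `m` and decides correctly under `θ` is therefore wrong under `u` with a
probability of order at least `exp (-(m * C))`, which has to be at most `α`. Exchanging the roles of
the hypotheses gives the bound for noise.
-/

namespace SeqTest

/-! ### Ville's inequality -/

section Ville

variable {X : Type*}

/-- The samples of size `n` such that one of their initial segments, of size `m ≤ n`, belongs to
`C m`. -/
def enteredBy (C : (n : ℕ) → Set (Fin n → X)) : (n : ℕ) → Set (Fin n → X)
  | 0 => C 0
  | n + 1 => Fin.init (α := fun _ => X) ⁻¹' enteredBy C n ∪ C (n + 1)

lemma subset_enteredBy (C : (n : ℕ) → Set (Fin n → X)) (n : ℕ) :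
    C n ⊆ enteredBy C n := by
  cases n with
  | zero => exact subset_rfl
  | succ n => exact Set.subset_union_right

lemma monotone_preimage_enteredBy (C : (n : ℕ) → Set (Fin n → X)) :
    Monotone fun n => pre n ⁻¹' enteredBy C n :=
  monotone_nat_of_le_succ fun _ _ hx => Or.inl hx

variable [MeasurableSpace X] {C : (n : ℕ) → Set (Fin n → X)}

lemma measurable_pre (n : ℕ) : Measurable (pre n : (ℕ → X) → Fin n → X) :=
  measurable_pi_lambda _ fun t => measurable_pi_apply (t : ℕ)

lemma measurable_init (n : ℕ) :
    Measurable (Fin.init (α := fun _ => X) : (Fin (n + 1) → X) → Fin n → X) :=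
  measurable_pi_lambda _ fun t => measurable_pi_apply t.castSucc

lemma measurable_snoc (n : ℕ) :
    Measurable (fun p : (Fin n → X) × X =>
      (Fin.snoc (α := fun _ => X) p.1 p.2 : Fin (n + 1) → X)) := by
  refine measurable_pi_lambda _ (Fin.lastCases ?_ fun i => ?_)
  · simpa using measurable_snd
  · simpa [Function.comp_def] using (measurable_pi_apply i).comp (measurable_fst (β := X))

lemma measurableSet_enteredBy (hC : ∀ n, MeasurableSet (C n)) (n : ℕ) :
    MeasurableSet (enteredBy C n) := by
  induction n with
  | zero => exact hC 0
  | succ n ih => exact (measurable_init n ih).union (hC (n + 1))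

lemma mul_measure_enteredBy_le {P : Measure (ℕ → X)} {Q : (n : ℕ) → Measure (Fin n → X)}
    {c : ℝ≥0∞} (hQ : ∀ n, (Q (n + 1)).map (Fin.init (α := fun _ => X)) = Q n)
    (hC : ∀ n, MeasurableSet (C n))
    (hPQ : ∀ n s, MeasurableSet s → s ⊆ C n → c * P (pre n ⁻¹' s) ≤ Q n s) (n : ℕ) :
    c * P (pre n ⁻¹' enteredBy C n) ≤ Q n (enteredBy C n) := by
  induction n with
  | zero => exact hPQ 0 _ (hC 0) subset_rfl
  | succ n ih =>
    set before := Fin.init (α := fun _ => X) ⁻¹' enteredBy C n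
    have hbefore : MeasurableSet before := measurable_init n (measurableSet_enteredBy hC n)
    have hnew : MeasurableSet (C (n + 1) \ before) := (hC (n + 1)).diff hbefore
    have hsplit : enteredBy C (n + 1) = before ∪ C (n + 1) \ before :=
      Set.union_sdiff_self.symm
    calc c * P (pre (n + 1) ⁻¹' enteredBy C (n + 1))
        ≤ c * P (pre n ⁻¹' enteredBy C n) + c * P (pre (n + 1) ⁻¹' (C (n + 1) \ before)) := by
          rw [hsplit, Set.preimage_union, ← mul_add]
          gcongr
          exact measure_union_le _ _
      _ ≤ Q n (enteredBy C n) + Q (n + 1) (C (n + 1) \ before) :=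
          add_le_add ih (hPQ _ _ hnew Set.sdiff_subset)
      _ = Q (n + 1) (enteredBy C (n + 1)) := by
          rw [hsplit, measure_union Set.disjoint_sdiff_right hnew, ← hQ n,
            Measure.map_apply (measurable_init n) (measurableSet_enteredBy hC n)]

/-- Ville's maximal inequality for the likelihood ratio of `Q` against `P`. Without assumptions on
`X`, the projective family `Q` need not extend to a measure on infinite sequences. -/
theorem mul_measure_exists_mem_le {P : Measure (ℕ → X)} {Q : (n : ℕ) → Measure (Fin n → X)}
    {c : ℝ≥0∞} (hQ : ∀ n, (Q (n + 1)).map (Fin.init (α := fun _ => X)) = Q n)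
    (hC : ∀ n, MeasurableSet (C n))
    (hPQ : ∀ n s, MeasurableSet s → s ⊆ C n → c * P (pre n ⁻¹' s) ≤ Q n s) :
    c * P {x | ∃ n, pre n x ∈ C n} ≤ Q 0 Set.univ := by
  have hmass (n : ℕ) : Q n Set.univ = Q 0 Set.univ := by
    induction n with
    | zero => rfl
    | succ n ih => rw [← ih, ← hQ n, Measure.map_apply (measurable_init n) .univ, Set.preimage_univ]
  have hsub : {x | ∃ n, pre n x ∈ C n} ⊆ ⋃ n, pre n ⁻¹' enteredBy C n :=
    fun _ ⟨n, hn⟩ => Set.mem_iUnion.2 ⟨n, subset_enteredBy C n hn⟩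
  calc c * P {x | ∃ n, pre n x ∈ C n} ≤ ⨆ n, c * P (pre n ⁻¹' enteredBy C n) := by
        rw [← ENNReal.mul_iSup, ← (monotone_preimage_enteredBy C).measure_iUnion]
        gcongr
    _ ≤ Q 0 Set.univ := iSup_le fun n =>
        (mul_measure_enteredBy_le hQ hC hPQ n).trans ((measure_mono (Set.subset_univ _)).trans_eq
          (hmass n))

end Ville

lemma exp_mul_withDensity_le {Ω : Type*} [MeasurableSpace Ω] {μ : Measure Ω} {f g : Ω → ℝ}
    {c : ℝ} {s : Set Ω} (hf : Measurable f) (hg : Measurable g) (hs : MeasurableSet s)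
    (h : ∀ x ∈ s, c + f x ≤ g x) :
    ENNReal.ofReal (Real.exp c) * μ.withDensity (fun x => ENNReal.ofReal (Real.exp (f x))) s ≤
      μ.withDensity (fun x => ENNReal.ofReal (Real.exp (g x))) s := by
  rw [withDensity_apply _ hs, withDensity_apply _ hs, ← lintegral_const_mul _ (by fun_prop)]
  refine setLIntegral_mono (by fun_prop) fun x hx => ?_
  rw [← ENNReal.ofReal_mul (Real.exp_nonneg _), ← Real.exp_add]
  exact ENNReal.ofReal_le_ofReal (Real.exp_le_exp.2 (h x hx))

lemma exp_neg_mul_of_exp_mul_le {c : ℝ} {p q : ℝ≥0∞}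
    (h : ENNReal.ofReal (Real.exp c) * p ≤ q) : p ≤ ENNReal.ofReal (Real.exp (-c)) * q := by
  rwa [Real.exp_neg, ENNReal.ofReal_inv_of_pos (Real.exp_pos c), ← ENNReal.mul_le_iff_le_inv
    (by simp [Real.exp_pos]) ENNReal.ofReal_ne_top]

namespace DataStream

variable {X : Type*} [MeasurableSpace X] (S : DataStream X) (E : Estimator S)

instance (θ : S.param) : IsProbabilityMeasure (S.law θ) := S.law_prob θ
instance (n : ℕ) : SigmaFinite (S.ref n) := S.ref_sigmaFinite n
instance (n : ℕ) : IsSFiniteKernel (S.refStep n) := S.refStep_sFinite n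

@[fun_prop]
lemma measurable_loglik (n : ℕ) (θ : S.param) : Measurable (S.loglik n θ) :=
  (S.loglik_measurable n).comp measurable_prodMk_left

lemma law_pre (n : ℕ) (θ : S.param) {s : Set (Fin n → X)} (hs : MeasurableSet s) :
    S.law θ (pre n ⁻¹' s) =
      (S.ref n).withDensity (fun h => ENNReal.ofReal (Real.exp (S.loglik n θ h))) s := by
  rw [← S.loglik_density, Measure.map_apply (measurable_pre n) hs]

lemma lintegral_ref_succ (n : ℕ) {f : (Fin (n + 1) → X) → ℝ≥0∞} (hf : Measurable f) :
    ∫⁻ h, f h ∂S.ref (n + 1) =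
      ∫⁻ h, ∫⁻ z, f (Fin.snoc (α := fun _ => X) h z) ∂S.refStep n h ∂S.ref n := by
  rw [S.ref_succ, lintegral_map hf (measurable_snoc n),
    Measure.lintegral_compProd (f := fun p => f (Fin.snoc (α := fun _ => X) p.1 p.2))
      (hf.comp (measurable_snoc n))]

/-- The adaptive log-likelihood of a sample of size `n`: each observation is predicted with the
parameter estimated from the previous ones. -/
noncomputable def predictiveLoglik : (n : ℕ) → (Fin n → X) → ℝ
  | 0, _ => 0
  | n + 1, h => predictiveLoglik n (Fin.init (α := fun _ => X) h) +
      (S.loglik (n + 1) (E.est n (Fin.init (α := fun _ => X) h)) h -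
        S.loglik n (E.est n (Fin.init (α := fun _ => X) h)) (Fin.init (α := fun _ => X) h))

lemma adaptive_eq (n : ℕ) (x : ℕ → X) :
    S.adaptive E n x = S.predictiveLoglik E n (pre n x) := by
  induction n with
  | zero => rfl
  | succ n ih => rw [adaptive, ih]; rfl

@[fun_prop]
lemma measurable_predictiveLoglik (n : ℕ) : Measurable (S.predictiveLoglik E n) := by
  induction n with
  | zero => exact measurable_const
  | succ n ih =>
    have hinit := measurable_init (X := X) n
    have hest := (E.est_measurable n).comp hinit
    exact (ih.comp hinit).add (((S.loglik_measurable (n + 1)).comp (hest.prodMk measurable_id)).sub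
      ((S.loglik_measurable n).comp (hest.prodMk hinit)))

/-- The law of a sample of size `n` whose density is the adaptive likelihood. -/
noncomputable def predictiveLaw (n : ℕ) : Measure (Fin n → X) :=
  (S.ref n).withDensity fun h => ENNReal.ofReal (Real.exp (S.predictiveLoglik E n h))

lemma predictiveLaw_zero_univ : S.predictiveLaw E 0 Set.univ = 1 := by
  obtain ⟨θ, -⟩ := S.null_nonempty
  have hdensity : S.predictiveLoglik E 0 = S.loglik 0 θ :=
    funext fun h => (S.loglik_zero θ h).symm
  rw [predictiveLaw, hdensity, ← S.law_pre 0 θ .univ, Set.preimage_univ, measure_univ]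

lemma ae_lintegral_exp_predictiveLoglik_snoc (n : ℕ) :
    ∀ᵐ h ∂S.ref n, ∫⁻ z, ENNReal.ofReal
        (Real.exp (S.predictiveLoglik E (n + 1) (Fin.snoc (α := fun _ => X) h z))) ∂S.refStep n h =
      ENNReal.ofReal (Real.exp (S.predictiveLoglik E n h)) := by
  filter_upwards [S.loglik_step n] with h hstep
  set r := S.predictiveLoglik E n h - S.loglik n (E.est n h) h
  have hsnoc (z : X) : S.predictiveLoglik E (n + 1) (Fin.snoc (α := fun _ => X) h z) =
      r + S.loglik (n + 1) (E.est n h) (Fin.snoc (α := fun _ => X) h z) := by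
    simp only [predictiveLoglik, Fin.init_snoc, r]
    ring
  have hmeas : Measurable fun z => ENNReal.ofReal
      (Real.exp (S.loglik (n + 1) (E.est n h) (Fin.snoc (α := fun _ => X) h z))) :=
    ((S.measurable_loglik _ _).comp
      ((measurable_snoc n).comp measurable_prodMk_left)).exp.ennreal_ofReal
  simp only [hsnoc, Real.exp_add, ENNReal.ofReal_mul (Real.exp_nonneg _)]
  rw [lintegral_const_mul _ hmeas, hstep, ← ENNReal.ofReal_mul (Real.exp_nonneg _), ← Real.exp_add,
    sub_add_cancel]

lemma map_init_predictiveLaw (n : ℕ) :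
    (S.predictiveLaw E (n + 1)).map (Fin.init (α := fun _ => X)) = S.predictiveLaw E n := by
  ext s hs
  have hinit := measurable_init n hs
  rw [Measure.map_apply (measurable_init n) hs, predictiveLaw, predictiveLaw,
    withDensity_apply _ hinit, withDensity_apply _ hs, ← lintegral_indicator hinit,
    ← lintegral_indicator hs, S.lintegral_ref_succ n (by fun_prop (disch := exact hinit))]
  refine lintegral_congr_ae ?_
  filter_upwards [S.ae_lintegral_exp_predictiveLoglik_snoc E n] with h hh
  by_cases hmem : h ∈ s <;> simp [Set.indicator, hmem, hh]

theorem law_exists_add_loglik_le_adaptive_le (θ : S.param) (a : ℝ) :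
    S.law θ {x | ∃ n, a + S.loglik n θ (pre n x) ≤ S.adaptive E n x} ≤
      ENNReal.ofReal (Real.exp (-a)) := by
  have hC (n : ℕ) : MeasurableSet {h | a + S.loglik n θ h ≤ S.predictiveLoglik E n h} :=
    measurableSet_le (by fun_prop) (by fun_prop)
  have hville := mul_measure_exists_mem_le (P := S.law θ) (c := ENNReal.ofReal (Real.exp a))
    (S.map_init_predictiveLaw E) hC fun n s hs hsub => by
      rw [S.law_pre n θ hs]
      exact exp_mul_withDensity_le (by fun_prop) (by fun_prop) hs hsub
  rw [predictiveLaw_zero_univ] at hville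
  simpa [adaptive_eq] using exp_neg_mul_of_exp_mul_le hville

/-! ### Crossing the thresholds -/

/-- The maximum log-likelihood over a set `Q` of parameters at time `n`; `maxNull` and `maxAlt` are
the cases `Q = null` and `Q = alt`, so that lemmas about `supLik` cover both hypotheses. -/
noncomputable def supLik (Q : Set S.param) (n : ℕ) (x : ℕ → X) : EReal :=
  ⨆ θ ∈ Q, (S.loglik n θ (pre n x) : EReal)

variable {S}

lemma loglik_le_supLik {Q : Set S.param} {θ : S.param} (hθ : θ ∈ Q) (n : ℕ) (x : ℕ → X) :
    (S.loglik n θ (pre n x) : EReal) ≤ S.supLik Q n x :=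
  le_iSup₂_of_le θ hθ le_rfl

/-- The evidence at time `n` for the hypothesis `R` against `Q` has reached level `a`. With the two
hypotheses of the stream as `Q` and `R`, this is the event that the adaptive log-likelihood ratio
has crossed the threshold `a > 0` on the side of `R`. -/
def Favors (Q R : Set S.param) (a : ℝ) (n : ℕ) (x : ℕ → X) : Prop :=
  S.supLik Q n x < S.supLik R n x ∧ (a : EReal) ≤ (S.adaptive E n x : EReal) - S.supLik Q n x

lemma le_adaptiveLLR_iff {a : ℝ} (ha : 0 < a) (n : ℕ) (x : ℕ → X) :
    (a : EReal) ≤ S.adaptiveLLR E n x ↔ Favors E S.null S.alt a n x := by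
  have ha' : (0 : EReal) < a := EReal.coe_pos.2 ha
  change _ ↔ S.maxNull n x < S.maxAlt n x ∧ _ ≤ _ - S.maxNull n x
  have hpos (h : (a : EReal) ≤ (S.adaptive E n x : EReal) - S.maxNull n x) :
      S.maxNull n x < S.adaptive E n x := EReal.sub_pos.1 (ha'.trans_le h)
  have hneg (h : S.maxAlt n x < S.adaptive E n x) :
      ¬(a : EReal) ≤ S.maxAlt n x - (S.adaptive E n x : EReal) :=
    (((EReal.sub_neg (by simp) (by simp)).2 h).trans ha').not_ge
  simp only [adaptiveLLR, lt_min_iff]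
  split_ifs with hnull halt
  · exact (and_iff_right hnull.1).symm
  · exact iff_of_false (hneg halt.2) fun h => hnull ⟨h.1, hpos h.2⟩
  · exact iff_of_false ha'.not_ge fun h => hnull ⟨h.1, hpos h.2⟩

lemma adaptiveLLR_le_neg_iff {b : ℝ} (hb : 0 < b) (n : ℕ) (x : ℕ → X) :
    S.adaptiveLLR E n x ≤ ((-b : ℝ) : EReal) ↔ Favors E S.alt S.null b n x := by
  have hb' : (0 : EReal) < b := EReal.coe_pos.2 hb
  have hb'' : ((-b : ℝ) : EReal) < 0 := EReal.coe_neg'.2 (neg_lt_zero.2 hb)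
  change _ ↔ S.maxAlt n x < S.maxNull n x ∧ _ ≤ _ - S.maxAlt n x
  have hpos (h : (b : EReal) ≤ (S.adaptive E n x : EReal) - S.maxAlt n x) :
      S.maxAlt n x < S.adaptive E n x := EReal.sub_pos.1 (hb'.trans_le h)
  have hneg (h : S.maxNull n x < S.adaptive E n x) :
      ¬(S.adaptive E n x : EReal) - S.maxNull n x ≤ ((-b : ℝ) : EReal) :=
    (hb''.trans (EReal.sub_pos.2 h)).not_ge
  have hflip : S.maxAlt n x - (S.adaptive E n x : EReal) ≤ ((-b : ℝ) : EReal) ↔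
      (b : EReal) ≤ (S.adaptive E n x : EReal) - S.maxAlt n x := by
    rw [EReal.coe_neg, EReal.le_neg, EReal.neg_sub (by simp) (by simp), add_comm,
      ← sub_eq_add_neg]
  simp only [adaptiveLLR, lt_min_iff]
  split_ifs with hnull halt
  · exact iff_of_false (hneg hnull.2) fun h => h.1.not_gt hnull.1
  · exact hflip.trans (and_iff_right halt.1).symm
  · exact iff_of_false hb''.not_ge fun h => halt ⟨h.1, hpos h.2⟩

lemma law_exists_favors_le {Q : Set S.param} (R : Set S.param) {θ : S.param} (hθ : θ ∈ Q)
    (a : ℝ) : S.law θ {x | ∃ n, Favors E Q R a n x} ≤ ENNReal.ofReal (Real.exp (-a)) := by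
  refine (measure_mono ?_).trans (S.law_exists_add_loglik_le_adaptive_le E θ a)
  rintro x ⟨n, -, ha⟩
  have hle := ha.trans (EReal.sub_le_sub le_rfl (loglik_le_supLik hθ n x))
  exact ⟨n, le_sub_iff_add_le.1 (by exact_mod_cast hle)⟩

lemma favors_of_lt {Q R : Set S.param} {θ : S.param} (hθ : θ ∈ R) {a c : ℝ} (hac : a ≤ c) {n : ℕ}
    {x : ℕ → X} (hQ : (c : EReal) < (S.adaptive E n x : EReal) - S.supLik Q n x)
    (hlt : S.adaptive E n x < c + S.loglik n θ (pre n x)) : Favors E Q R a n x := by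
  refine ⟨lt_of_lt_of_le ?_ (loglik_le_supLik hθ n x), (EReal.coe_le_coe hac).trans hQ.le⟩
  calc S.supLik Q n x < (S.adaptive E n x : EReal) - c := by
        rw [EReal.lt_sub_iff_add_lt (by simp) (by simp), add_comm]
        exact EReal.add_lt_of_lt_sub hQ
    _ < S.loglik n θ (pre n x) := by
        exact_mod_cast sub_left_lt_of_lt_add hlt

/-- Complete convergence only compares the adaptive log-likelihood with the hypothesis `Q`. That
`R` is also the likelier hypothesis follows from Ville's inequality for the true `θ ∈ R`. -/
lemma law_not_favors_le {Q R : Set S.param} {θ : S.param} (hθ : θ ∈ R) {a s : ℝ} {n : ℕ}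
    (hn : 0 < n) (ha : a ≤ s * n) :
    S.law θ {x | ¬Favors E Q R a n x} ≤
      S.law θ {x | ((S.adaptive E n x : EReal) - S.supLik Q n x) / (n : EReal) ≤ (s : EReal)} +
        ENNReal.ofReal (Real.exp (-(s * n))) := by
  refine (measure_mono ?_).trans ((measure_union_le _ _).trans
    (add_le_add_right (S.law_exists_add_loglik_le_adaptive_le E θ (s * n)) _))
  intro x hx
  contrapose! hx
  simp only [Set.mem_union, Set.mem_ofPred_eq, not_or, not_exists, not_le] at hx
  have hslope := (EReal.lt_div_iff (by exact_mod_cast hn) (EReal.natCast_ne_top n)).1 hx.1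
  rw [Set.mem_ofPred_eq, not_not]
  exact favors_of_lt E hθ ha (by exact_mod_cast hslope) (hx.2 n)

lemma exists_tsum_lt_top_law_not_favors_le {Q R : Set S.param} {θ : S.param} (hθ : θ ∈ R) {s : ℝ}
    (hs : 0 < s)
    (hconv : ∑' n : ℕ, S.law θ {x | ((S.adaptive E (n + 1) x : EReal) - S.supLik Q (n + 1) x) /
      ((n + 1 : ℕ) : EReal) ≤ (s : EReal)} < ∞) :
    ∃ p : ℕ → ℝ≥0∞, ∑' n, p n < ∞ ∧ ∀ (a : ℝ) (n : ℕ), a ≤ s * (n + 1 : ℕ) →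
      S.law θ {x | ¬Favors E Q R a (n + 1) x} ≤ p n := by
  refine ⟨_, ?_, fun a n ha => law_not_favors_le E hθ n.succ_pos ha⟩
  have hgeom : Summable fun n : ℕ => Real.exp (-(s * (n + 1 : ℕ))) := by
    simpa [mul_comm] using
      (summable_nat_add_iff 1).2 (Real.summable_exp_nat_mul_iff.2 (neg_lt_zero.2 hs))
  rw [ENNReal.tsum_add, ENNReal.add_lt_top]
  exact ⟨hconv, hgeom.tsum_ofReal_lt_top⟩

lemma measurable_adaptiveLLR {Ω : Type*} [MeasurableSpace Ω] {f : Ω → ℕ → X} {n : ℕ}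
    (hf : Measurable fun ω => pre n (f ω)) : Measurable fun ω => S.adaptiveLLR E n (f ω) := by
  have hnull : Measurable fun ω => S.maxNull n (f ω) := (S.sup_null_measurable n).comp hf
  have halt : Measurable fun ω => S.maxAlt n (f ω) := (S.sup_alt_measurable n).comp hf
  have hadaptive : Measurable fun ω => (S.adaptive E n (f ω) : EReal) := by
    simp only [adaptive_eq]
    exact ((S.measurable_predictiveLoglik E n).comp hf).coe_real_ereal
  exact Measurable.ite (measurableSet_lt hnull (halt.min hadaptive)) (hadaptive.sub hnull) <|
    Measurable.ite (measurableSet_lt halt (hnull.min hadaptive)) (halt.sub hadaptive)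
      measurable_const

end DataStream

/-! ### Random times -/

section RandomTime

variable {Ω : Type*} [MeasurableSpace Ω] {μ : Measure Ω} {T : Ω → ℕ∞}

lemma toENNReal_eq_tsum_ite (t : ℕ∞) :
    (t : ℝ≥0∞) = ∑' n : ℕ, if (n : ℕ∞) < t then (1 : ℝ≥0∞) else 0 := by
  induction t using ENat.recTopCoe with
  | top => simp
  | coe m =>
    rw [tsum_eq_sum (s := Finset.range m) fun n hn => if_neg (by simpa using hn),
      Finset.sum_congr rfl fun n hn => if_pos (by exact_mod_cast Finset.mem_range.1 hn)]
    simp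

lemma lintegral_eq_tsum_measure_lt (hT : Measurable T) :
    ∫⁻ ω, (T ω : ℝ≥0∞) ∂μ = ∑' n : ℕ, μ {ω | (n : ℕ∞) < T ω} := by
  have hlt (n : ℕ) : MeasurableSet {ω | (n : ℕ∞) < T ω} :=
    hT (.of_discrete (s := Set.Ioi (n : ℕ∞)))
  simp_rw [toENNReal_eq_tsum_ite (T _)]
  rw [lintegral_tsum fun n =>
    (Measurable.ite (hlt n) measurable_const measurable_const).aemeasurable]
  refine tsum_congr fun n => ?_
  rw [← lintegral_indicator_one (hlt n)]
  simp only [Set.indicator_apply, Set.mem_ofPred_eq, Pi.one_apply]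

lemma mul_measure_lt_le_lintegral (hT : Measurable T) (m : ℕ) :
    ((m + 1 : ℕ) : ℝ≥0∞) * μ {ω | (m : ℕ∞) < T ω} ≤ ∫⁻ ω, (T ω : ℝ≥0∞) ∂μ := by
  have hsucc (t : ℕ∞) : ((m + 1 : ℕ) : ℝ≥0∞) ≤ t ↔ (m : ℕ∞) < t := by
    rw [← ENat.toENNReal_coe, ENat.toENNReal_le, Nat.cast_add_one,
      ENat.add_one_le_iff (ENat.natCast_ne_top m)]
  have hmeas : Measurable fun ω => (T ω : ℝ≥0∞) :=
    (Measurable.of_discrete (f := ENat.toENNReal)).comp hT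
  simpa only [hsucc] using mul_meas_ge_le_lintegral (μ := μ) hmeas ((m + 1 : ℕ) : ℝ≥0∞)

lemma ofReal_mul_le_lintegral_of_measure_le_floor_le [IsProbabilityMeasure μ] (hT : Measurable T)
    {s t x : ℝ} (hs : 0 < s) (hst : s < t) (hx : 0 ≤ x)
    (h : μ {ω | T ω ≤ ⌊t * x⌋₊} ≤ ENNReal.ofReal (1 - s / t)) :
    ENNReal.ofReal (s * x) ≤ ∫⁻ ω, (T ω : ℝ≥0∞) ∂μ := by
  have ht : 0 < t := hs.trans hst
  have hle : MeasurableSet {ω | T ω ≤ ⌊t * x⌋₊} := hT (.of_discrete (s := Set.Iic _))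
  have hlate : ENNReal.ofReal (s / t) ≤ μ {ω | (⌊t * x⌋₊ : ℕ∞) < T ω} := by
    calc ENNReal.ofReal (s / t) = 1 - ENNReal.ofReal (1 - s / t) := by
          have hle_one : s / t ≤ 1 := ((div_lt_one ht).2 hst).le
          rw [← ENNReal.ofReal_one, ← ENNReal.ofReal_sub _ (sub_nonneg.2 hle_one), sub_sub_cancel]
      _ ≤ 1 - μ {ω | T ω ≤ ⌊t * x⌋₊} := tsub_le_tsub_left h 1
      _ = μ {ω | (⌊t * x⌋₊ : ℕ∞) < T ω} := by
          simp only [← prob_compl_eq_one_sub hle, Set.compl_ofPred, not_le]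
  calc ENNReal.ofReal (s * x) = ENNReal.ofReal (t * x) * ENNReal.ofReal (s / t) := by
        rw [← ENNReal.ofReal_mul (by positivity)]
        congr 1
        field_simp
    _ ≤ (⌊t * x⌋₊ + 1 : ℕ) * μ {ω | (⌊t * x⌋₊ : ℕ∞) < T ω} := by
        gcongr
        rw [← ENNReal.ofReal_natCast]
        exact ENNReal.ofReal_le_ofReal (by exact_mod_cast (Nat.lt_floor_add_one _).le)
    _ ≤ _ := mul_measure_lt_le_lintegral hT _

lemma lintegral_le_add_tsum [IsProbabilityMeasure μ] (hT : Measurable T) {m : ℕ} {p : ℕ → ℝ≥0∞}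
    (h : ∀ n, m ≤ n → μ {ω | ((n + 1 : ℕ) : ℕ∞) < T ω} ≤ p n) :
    ∫⁻ ω, (T ω : ℝ≥0∞) ∂μ ≤ (m + 1 : ℕ) + ∑' n, p n := by
  rw [lintegral_eq_tsum_measure_lt hT, ← ENNReal.summable.sum_add_tsum_nat_add' (k := m + 1)]
  refine add_le_add ?_ ?_
  · simpa using Finset.sum_le_card_nsmul (Finset.range (m + 1))
      (fun n => μ {ω | (n : ℕ∞) < T ω}) 1 fun _ _ => prob_le_one
  · calc ∑' n, μ {ω | ((n + (m + 1) : ℕ) : ℕ∞) < T ω} ≤ ∑' n, p (n + m) :=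
          ENNReal.tsum_le_tsum fun n => h (n + m) (Nat.le_add_left m n)
      _ ≤ ∑' n, p n := ENNReal.tsum_comp_le_tsum_of_injective (add_left_injective m) p

end RandomTime

section Procedures

variable {K : ℕ} {X : Fin K → Type*} [∀ k, MeasurableSpace (X k)] {k : Fin K}

lemma streamSigma_eq_comap (k : Fin K) (n : ℕ) :
    streamSigma X k n = MeasurableSpace.comap (fun ω => pre n (ω k)) inferInstance := by
  simp only [streamSigma, MeasurableSpace.pi, MeasurableSpace.comap_iSup,
    MeasurableSpace.comap_comp]
  rfl

/-- The filtration of the information provided by stream `k` alone. -/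
def streamFiltration (X : Fin K → Type*) [∀ k, MeasurableSpace (X k)] (k : Fin K) :
    Filtration ℕ (MeasurableSpace.pi : MeasurableSpace (∀ k, ℕ → X k)) where
  seq := streamSigma X k
  mono' _ _ hmn := iSup_le fun t => le_iSup_of_le (t.castLE hmn) le_rfl
  le' _ := iSup_le fun t => Measurable.comap_le
    ((measurable_pi_apply (t : ℕ)).comp (measurable_pi_apply k))

lemma Procedure.AdaptedTo.measurable_time {χ : Procedure X}
    (hχ : χ.AdaptedTo fun k n => streamSigma X k n) (k : Fin K) : Measurable (χ.time k) :=
  ENat.measurable_iff.2 fun n => (streamFiltration X k).le n _ ((hχ k).2.2 n).1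

variable {S : ∀ k, DataStream (X k)} {E : ∀ k, Estimator (S k)} {a b : ℝ} {ω : ∀ k, ℕ → X k}
  {n : ℕ}

lemma sprtTime_le (hn : 1 ≤ n)
    (h : (S k).adaptiveLLR (E k) n (ω k) ∉ Set.Ioo ((-b : ℝ) : EReal) (a : EReal)) :
    sprtTime S E a b k ω ≤ n :=
  iInf₂_le n ⟨hn, h⟩

variable (S E a b k) in
lemma sprtTime_eq_hittingAfter :
    sprtTime S E a b k = hittingAfter (fun n ω => (S k).adaptiveLLR (E k) n (ω k))
      (Set.Ioo ((-b : ℝ) : EReal) (a : EReal))ᶜ 1 := by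
  refine funext fun ω => le_antisymm ?_ (le_iInf₂ fun n hn => hittingAfter_le_of_mem hn.1 hn.2)
  by_cases htop : hittingAfter (fun n ω => (S k).adaptiveLLR (E k) n (ω k))
      (Set.Ioo ((-b : ℝ) : EReal) (a : EReal))ᶜ 1 ω = ⊤
  · exact htop ▸ le_top
  · have hmem := hittingAfter_mem_set_of_ne_top htop
    have hone := le_hittingAfter (u := fun n (ω : ∀ k, ℕ → X k) => (S k).adaptiveLLR (E k) n (ω k))
      (s := (Set.Ioo ((-b : ℝ) : EReal) (a : EReal))ᶜ) (n := 1) ω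
    lift hittingAfter (fun n ω => (S k).adaptiveLLR (E k) n (ω k))
      (Set.Ioo ((-b : ℝ) : EReal) (a : EReal))ᶜ 1 ω to ℕ using htop with n
    exact sprtTime_le (WithTop.coe_le_coe.1 hone) hmem

lemma adaptiveLLR_notMem_of_sprtTime_eq (h : sprtTime S E a b k ω = n) :
    (S k).adaptiveLLR (E k) n (ω k) ∉ Set.Ioo ((-b : ℝ) : EReal) (a : EReal) := by
  rw [sprtTime_eq_hittingAfter] at h
  have hmem := hittingAfter_mem_set_of_ne_top (h ▸ ENat.natCast_ne_top n)
  rwa [h] at hmem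

lemma adapted_adaptiveLLR (k : Fin K) :
    Adapted (streamFiltration X k) fun n ω => (S k).adaptiveLLR (E k) n (ω k) := by
  intro n
  have hpre : Measurable[streamSigma X k n] fun ω : ∀ k, ℕ → X k => pre n (ω k) := by
    rw [streamSigma_eq_comap]
    exact comap_measurable _
  exact @DataStream.measurable_adaptiveLLR _ _ _ (E k) _ (streamSigma X k n) _ n hpre

lemma isStoppingTime_sprtTime (k : Fin K) :
    IsStoppingTime (streamFiltration X k) (sprtTime S E a b k) := by
  rw [sprtTime_eq_hittingAfter]
  exact (adapted_adaptiveLLR k).isStoppingTime_hittingAfter measurableSet_Ioo.compl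

lemma sprt_dec_iff (h : sprtTime S E a b k ω = n) :
    (sprt S E a b).dec k ω ↔ (a : EReal) ≤ (S k).adaptiveLLR (E k) n (ω k) := by
  refine ⟨?_, fun hle => ⟨n, h, hle⟩⟩
  rintro ⟨m, hm, hle⟩
  rwa [Nat.cast_injective (h.symm.trans hm)]

variable (S E a b) in
lemma sprt_adaptedTo : (sprt S E a b).AdaptedTo fun k n => streamSigma X k n := by
  intro k
  have htime (n : ℕ) : MeasurableSet[streamSigma X k n] {ω | sprtTime S E a b k ω = n} :=
    (isStoppingTime_sprtTime k).measurableSet_eq n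
  have hlarge (n : ℕ) : MeasurableSet[streamSigma X k n]
      {ω | (a : EReal) ≤ (S k).adaptiveLLR (E k) n (ω k)} :=
    adapted_adaptiveLLR k n measurableSet_Ici
  refine ⟨fun ω => le_iInf₂ fun n hn => by exact_mod_cast hn.1, ?_, fun n => ⟨htime n, ?_, ?_⟩⟩
  · have hdec : {ω | (sprt S E a b).dec k ω} = ⋃ n : ℕ, {ω | sprtTime S E a b k ω = n} ∩
        {ω | (a : EReal) ≤ (S k).adaptiveLLR (E k) n (ω k)} := by
      ext ω
      simp [sprt]
    rw [hdec]
    exact .iUnion fun n => (streamFiltration X k).le n _ ((htime n).inter (hlarge n))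
  · convert (htime n).inter (hlarge n) using 1
    exact Set.ext fun ω => and_congr_right sprt_dec_iff
  · convert (htime n).diff (hlarge n) using 1
    exact Set.ext fun ω => and_congr_right fun h => not_congr (sprt_dec_iff h)

variable (S E a b) in
lemma sprt_mem_decentralized : sprt S E a b ∈ decentralized X := by
  have hadapted := sprt_adaptedTo S E a b
  have hle (k : Fin K) (n : ℕ) : streamSigma X k n ≤ allSigma X n :=
    le_iSup (fun k => streamSigma X k n) k
  exact ⟨fun k => ⟨(hadapted k).1, (hadapted k).2.1, fun n =>
    ((hadapted k).2.2 n).imp (hle k n _) (And.imp (hle k n _) (hle k n _))⟩, hadapted⟩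

end Procedures

/-! ### Error probabilities and mean decision times of the parallel test -/

lemma measure_exists_mem_le_of_log_card_le {Ω ι : Type*} [MeasurableSpace Ω] {μ : Measure Ω}
    {A : Finset ι} {D : ι → Ω → Prop} {r M : ℝ} (hr : r ∈ Set.Ioo 0 1)
    (hM : Real.log A.card ≤ M)
    (h : ∀ j ∈ A, μ {ω | D j ω} ≤ ENNReal.ofReal (Real.exp (-(|Real.log r| + M)))) :
    μ {ω | ∃ j ∈ A, D j ω} ≤ ENNReal.ofReal r := by
  have hunion : {ω | ∃ j ∈ A, D j ω} = ⋃ j ∈ A, {ω | D j ω} := by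
    ext ω
    simp
  have hcard : (A.card : ℝ) * Real.exp (-(|Real.log r| + M)) ≤ r := by
    rcases A.card.eq_zero_or_pos with hzero | hpos
    · simp [hzero, hr.1.le]
    · have hle : (A.card : ℝ) ≤ Real.exp M :=
        (Real.log_le_iff_le_exp (Nat.cast_pos.2 hpos)).1 hM
      calc (A.card : ℝ) * Real.exp (-(|Real.log r| + M))
          ≤ Real.exp M * Real.exp (-(|Real.log r| + M)) := by gcongr
        _ = r := by
          rw [← Real.exp_add, abs_of_neg (Real.log_neg hr.1 hr.2)]
          simp [Real.exp_log hr.1]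
  calc μ {ω | ∃ j ∈ A, D j ω} ≤ ∑ j ∈ A, μ {ω | D j ω} :=
        hunion ▸ measure_biUnion_finset_le A _
    _ ≤ A.card • ENNReal.ofReal (Real.exp (-(|Real.log r| + M))) := Finset.sum_le_card_nsmul _ _ _ h
    _ = ENNReal.ofReal (A.card * Real.exp (-(|Real.log r| + M))) := by
        rw [nsmul_eq_mul, ENNReal.ofReal_mul (Nat.cast_nonneg _), ENNReal.ofReal_natCast]
    _ ≤ ENNReal.ofReal r := ENNReal.ofReal_le_ofReal hcard

section JointLaw

variable {K : ℕ} {X : Fin K → Type*} [∀ k, MeasurableSpace (X k)] {S : ∀ k, DataStream (X k)}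
  {E : ∀ k, Estimator (S k)} {θ : ∀ k, (S k).param} {k : Fin K} {a b s : ℝ}

instance (θ : ∀ k, (S k).param) : IsProbabilityMeasure (jointLaw S θ) :=
  inferInstanceAs (IsProbabilityMeasure (Measure.pi fun k => (S k).law (θ k)))

lemma measurePreserving_eval_jointLaw (θ : ∀ k, (S k).param) (k : Fin K) :
    MeasurePreserving (Function.eval k) (jointLaw S θ) ((S k).law (θ k)) :=
  measurePreserving_eval _ k

lemma jointLaw_eval_mem_le (θ : ∀ k, (S k).param) (k : Fin K) (s : Set (ℕ → X k)) :
    jointLaw S θ {ω | ω k ∈ s} ≤ (S k).law (θ k) s := by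
  rw [← (measurePreserving_eval_jointLaw θ k).map_eq]
  exact Measure.le_map_apply (measurable_pi_apply (X := fun k => ℕ → X k) k).aemeasurable s

lemma exists_lintegral_le_of_favors {Q R : Set (S k).param} (hθ : θ k ∈ R) (hs : 0 < s)
    (hconv : ∑' n : ℕ, (S k).law (θ k) {x | (((S k).adaptive (E k) (n + 1) x : EReal) -
      (S k).supLik Q (n + 1) x) / ((n + 1 : ℕ) : EReal) ≤ (s : EReal)} < ∞) :
    ∃ c < ∞, ∀ (a : ℝ) (T : (∀ k, ℕ → X k) → ℕ∞), 0 < a → Measurable T →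
      (∀ n ω, DataStream.Favors (E k) Q R a (n + 1) (ω k) → T ω ≤ (n + 1 : ℕ)) →
      ∫⁻ ω, (T ω : ℝ≥0∞) ∂jointLaw S θ ≤ ENNReal.ofReal (a / s) + c := by
  obtain ⟨p, hp, hfavors⟩ := DataStream.exists_tsum_lt_top_law_not_favors_le (E k) hθ hs hconv
  refine ⟨2 + ∑' n, p n, by finiteness, fun a T ha hT hle => ?_⟩
  have htail (n : ℕ) (hn : ⌈a / s⌉₊ ≤ n) :
      jointLaw S θ {ω | ((n + 1 : ℕ) : ℕ∞) < T ω} ≤ p n := by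
    have han : a ≤ s * (n + 1 : ℕ) := (div_le_iff₀' hs).1 (Nat.ceil_le.1 (hn.trans n.le_succ))
    exact (measure_mono fun ω hω h => (hle n ω h).not_gt hω).trans
      ((jointLaw_eval_mem_le θ k _).trans (hfavors a n han))
  have hceil : ((⌈a / s⌉₊ + 1 : ℕ) : ℝ≥0∞) ≤ ENNReal.ofReal (a / s) + 2 := by
    rw [← ENNReal.ofReal_natCast, ← ENNReal.ofReal_ofNat, ← ENNReal.ofReal_add (by positivity)
      zero_le_two]
    refine ENNReal.ofReal_le_ofReal ?_
    have := Nat.ceil_lt_add_one (a := a / s) (by positivity)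
    push_cast
    linarith
  calc ∫⁻ ω, (T ω : ℝ≥0∞) ∂jointLaw S θ ≤ (⌈a / s⌉₊ + 1 : ℕ) + ∑' n, p n :=
        lintegral_le_add_tsum hT htail
    _ ≤ ENNReal.ofReal (a / s) + (2 + ∑' n, p n) := by
        rw [← add_assoc]
        gcongr

lemma exists_expTime_sprt_le_of_mem_alt {I : (S k).param → (S k).param → ℝ}
    (hconv : (S k).CompleteConvergence (E k) I) (hθ : θ k ∈ (S k).alt) (hs : 0 < s)
    (hsI : s < (S k).rateNull I (θ k)) :
    ∃ c < ∞, ∀ a b : ℝ, 0 < a → expTime S θ (sprt S E a b) k ≤ ENNReal.ofReal (a / s) + c := by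
  have htail := hconv.1 (θ k) hθ _ (sub_pos.2 hsI)
  simp only [sub_sub_cancel] at htail
  obtain ⟨c, hc, hle⟩ := exists_lintegral_le_of_favors (Q := (S k).null) hθ hs htail
  refine ⟨c, hc, fun a b ha => hle a _ ha ((sprt_adaptedTo S E a b).measurable_time k) ?_⟩
  exact fun n ω h => sprtTime_le n.succ_pos fun hmem =>
    ((DataStream.le_adaptiveLLR_iff (E k) ha _ _).2 h).not_gt hmem.2

lemma exists_expTime_sprt_le_of_mem_null {I : (S k).param → (S k).param → ℝ}
    (hconv : (S k).CompleteConvergence (E k) I) (hθ : θ k ∈ (S k).null) (hs : 0 < s)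
    (hsI : s < (S k).rateAlt I (θ k)) :
    ∃ c < ∞, ∀ a b : ℝ, 0 < b → expTime S θ (sprt S E a b) k ≤ ENNReal.ofReal (b / s) + c := by
  have htail := hconv.2 (θ k) hθ _ (sub_pos.2 hsI)
  simp only [sub_sub_cancel] at htail
  obtain ⟨c, hc, hle⟩ := exists_lintegral_le_of_favors (Q := (S k).alt) hθ hs htail
  refine ⟨c, hc, fun a b hb => hle b _ hb ((sprt_adaptedTo S E a b).measurable_time k) ?_⟩
  exact fun n ω h => sprtTime_le n.succ_pos fun hmem =>
    ((DataStream.adaptiveLLR_le_neg_iff (E k) hb _ _).2 h).not_gt hmem.1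

lemma ae_time_lt_top {χ : Procedure X} (hχ : χ.AdaptedTo fun k n => streamSigma X k n)
    (h : expTime S θ χ k < ∞) : ∀ᵐ ω ∂jointLaw S θ, χ.time k ω < ⊤ := by
  have hmeas : Measurable fun ω => (χ.time k ω : ℝ≥0∞) :=
    (Measurable.of_discrete (f := ENat.toENNReal)).comp (hχ.measurable_time k)
  filter_upwards [ae_lt_top hmeas h.ne] with ω hω
  exact ENat.toENNReal_lt_top.1 hω

lemma ae_sprt_time_lt_top {I : ∀ k, (S k).param → (S k).param → ℝ}
    (hsep : ∀ k, (S k).Separated (I k)) (hconv : ∀ k, (S k).CompleteConvergence (E k) (I k))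
    {A : Finset (Fin K)} (hθ : θ ∈ consistent S A) (ha : 0 < a) (hb : 0 < b) (k : Fin K) :
    ∀ᵐ ω ∂jointLaw S θ, (sprt S E a b).time k ω < ⊤ := by
  refine ae_time_lt_top (sprt_adaptedTo S E a b) ?_
  by_cases hk : k ∈ A
  · have hpos := (hsep k).1 (θ k) (hθ.1 k hk)
    obtain ⟨c, hc, hle⟩ := exists_expTime_sprt_le_of_mem_alt (hconv k) (hθ.1 k hk) (half_pos hpos)
      (half_lt_self hpos)
    exact (hle a b ha).trans_lt (by finiteness)
  · have hpos := (hsep k).2 (θ k) (hθ.2 k hk)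
    obtain ⟨c, hc, hle⟩ := exists_expTime_sprt_le_of_mem_null (hconv k) (hθ.2 k hk) (half_pos hpos)
      (half_lt_self hpos)
    exact (hle a b hb).trans_lt (by finiteness)

lemma jointLaw_sprt_dec_le (hθ : θ k ∈ (S k).null) (ha : 0 < a) :
    jointLaw S θ {ω | (sprt S E a b).dec k ω} ≤ ENNReal.ofReal (Real.exp (-a)) := by
  refine (measure_mono ?_).trans ((jointLaw_eval_mem_le θ k _).trans
    (DataStream.law_exists_favors_le (E k) (S k).alt hθ a))
  rintro ω ⟨n, -, h⟩
  exact ⟨n, (DataStream.le_adaptiveLLR_iff (E k) ha n _).1 h⟩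

lemma jointLaw_not_sprt_dec_le (hθ : θ k ∈ (S k).alt) (hb : 0 < b)
    (htop : ∀ᵐ ω ∂jointLaw S θ, (sprt S E a b).time k ω < ⊤) :
    jointLaw S θ {ω | ¬(sprt S E a b).dec k ω} ≤ ENNReal.ofReal (Real.exp (-b)) := by
  refine (measure_mono_ae ?_).trans ((jointLaw_eval_mem_le θ k _).trans
    (DataStream.law_exists_favors_le (E k) (S k).null hθ b))
  filter_upwards [htop] with ω hω hdec
  obtain ⟨n, hn⟩ := ENat.ne_top_iff_exists.1 hω.ne
  have hlt : (S k).adaptiveLLR (E k) n (ω k) < a :=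
    not_le.1 (mt (sprt_dec_iff hn.symm).2 hdec)
  have hle : (S k).adaptiveLLR (E k) n (ω k) ≤ ((-b : ℝ) : EReal) :=
    not_lt.1 fun h => adaptiveLLR_notMem_of_sprtTime_eq hn.symm ⟨h, hlt⟩
  exact ⟨n, (DataStream.adaptiveLLR_le_neg_iff (E k) hb n _).1 hle⟩

end JointLaw

/-! ### The lower bound -/

lemma eventually_forall_le_mul {z : ℕ → ℝ} {c : ℝ} (hc : 0 < c)
    (h : ∀ᶠ n in atTop, z n ≤ n * c) : ∀ᶠ m : ℕ in atTop, ∀ n ≤ m, z n ≤ m * c := by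
  obtain ⟨N, hN⟩ := eventually_atTop.1 h
  have hinit : ∀ᶠ m : ℕ in atTop, ∀ n ∈ Finset.range N, z n ≤ m * c :=
    (Finset.eventually_all _).2 fun n _ =>
      (tendsto_natCast_atTop_atTop.atTop_mul_const hc).eventually_ge_atTop (z n)
  filter_upwards [hinit] with m hm n hnm
  rcases lt_or_ge n N with hlt | hge
  · exact hm n (Finset.mem_range.2 hlt)
  · exact (hN n hge).trans (by gcongr)

lemma measure_time_le_le {Ω : Type*} [MeasurableSpace Ω] {μ ν : Measure Ω} {T : Ω → ℕ∞}
    {D : Set Ω} {R : ℕ → Set Ω} {C : ℝ≥0∞} (hTD : ∀ n : ℕ, MeasurableSet ({ω | T ω = n} ∩ D))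
    (hR : ∀ n : ℕ, μ (({ω | T ω = n} ∩ D) ∩ R n) ≤ C * ν ({ω | T ω = n} ∩ D)) (m : ℕ) :
    μ {ω | T ω ≤ m} ≤ μ Dᶜ + (C * ν D + μ {ω | ∃ n ≤ m, ω ∉ R n}) := by
  have hsub : {ω | T ω ≤ m} ⊆ Dᶜ ∪ ((⋃ n ∈ Finset.range (m + 1), ({ω | T ω = n} ∩ D) ∩ R n) ∪
      {ω | ∃ n ≤ m, ω ∉ R n}) := by
    intro ω hω
    obtain ⟨n, hn⟩ := ENat.ne_top_iff_exists.1 (ne_top_of_le_ne_top (ENat.natCast_ne_top m) hω)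
    have hnm : n ≤ m := by exact_mod_cast hn.trans_le hω
    by_cases hD : ω ∈ D
    · by_cases hωR : ω ∈ R n
      · exact .inr (.inl (Set.mem_biUnion (Finset.mem_range_succ_iff.2 hnm) ⟨⟨hn.symm, hD⟩, hωR⟩))
      · exact .inr (.inr ⟨n, hnm, hωR⟩)
    · exact .inl hD
  have hdisj : Pairwise (Function.onFun Disjoint fun n : ℕ => {ω | T ω = n} ∩ D) :=
    fun i j hij => Set.disjoint_left.2 fun ω hi hj =>
      hij (Nat.cast_injective (hi.1.symm.trans hj.1))
  have hunion : μ (⋃ n ∈ Finset.range (m + 1), ({ω | T ω = n} ∩ D) ∩ R n) ≤ C * ν D := by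
    calc μ (⋃ n ∈ Finset.range (m + 1), ({ω | T ω = n} ∩ D) ∩ R n)
        ≤ ∑ n ∈ Finset.range (m + 1), C * ν ({ω | T ω = n} ∩ D) :=
          (measure_biUnion_finset_le _ _).trans (Finset.sum_le_sum fun n _ => hR n)
      _ = C * ν (⋃ n ∈ Finset.range (m + 1), {ω | T ω = n} ∩ D) := by
          rw [← Finset.mul_sum, measure_biUnion_finset (hdisj.set_pairwise _) fun n _ => hTD n]
      _ ≤ C * ν D := by
          gcongr
          exact Set.iUnion₂_subset fun n _ => Set.inter_subset_right
  calc μ {ω | T ω ≤ m} ≤ _ := measure_mono hsub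
    _ ≤ _ := (measure_union_le _ _).trans (add_le_add_right (measure_union_le _ _) _)
    _ ≤ _ := by gcongr

namespace DataStream

variable {X : Type*} [MeasurableSpace X] {S : DataStream X}

variable (S) in
/-- The event that the log-likelihood ratio of `θ` against `u` exceeds `c` by time `m`. -/
def ratioExceeds (θ u : S.param) (m : ℕ) (c : ℝ) : Set (ℕ → X) :=
  {x | ∃ n ≤ m, ¬S.loglik n θ (pre n x) - S.loglik n u (pre n x) ≤ c}

lemma measurableSet_ratioExceeds (θ u : S.param) (m : ℕ) (c : ℝ) :
    MeasurableSet (S.ratioExceeds θ u m c) := by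
  have hloglik (n : ℕ) (θ : S.param) : Measurable fun x => S.loglik n θ (pre n x) :=
    (S.measurable_loglik n θ).comp (measurable_pre n)
  have hunion : S.ratioExceeds θ u m c = ⋃ n ∈ Finset.range (m + 1),
      {x | S.loglik n θ (pre n x) - S.loglik n u (pre n x) ≤ c}ᶜ := by
    ext x
    simp [ratioExceeds]
  rw [hunion]
  exact Finset.measurableSet_biUnion _ fun n _ =>
    (measurableSet_le ((hloglik n θ).sub (hloglik n u)) measurable_const).compl

lemma tendsto_law_ratioExceeds {I : S.param → S.param → ℝ} (hI : S.RateBound I) {θ u : S.param}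
    {c : ℝ} (hc : I θ u < c) :
    Tendsto (fun m : ℕ => S.law θ (S.ratioExceeds θ u m (m * c))) atTop (𝓝 0) := by
  obtain ⟨hpos, hlimsup⟩ := hI θ u
  rw [← measure_empty (μ := S.law θ)]
  refine tendsto_measure_of_ae_tendsto_indicator_of_isFiniteMeasure atTop MeasurableSet.empty
    (fun m => measurableSet_ratioExceeds θ u m _) ?_
  filter_upwards [hlimsup] with x hx
  have hle : ∀ᶠ n : ℕ in atTop, S.loglik n θ (pre n x) - S.loglik n u (pre n x) ≤ n * c := by
    filter_upwards [eventually_lt_of_limsup_lt (hx.trans_lt (EReal.coe_lt_coe hc)),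
      eventually_gt_atTop 0] with n hn hn0
    exact ((div_lt_iff₀' (Nat.cast_pos.2 hn0)).1 (EReal.coe_lt_coe_iff.1 hn)).le
  filter_upwards [eventually_forall_le_mul (hpos.trans hc) hle] with m hm
  refine iff_of_false ?_ (Set.notMem_empty x)
  rintro ⟨n, hnm, hlt⟩
  exact hlt (hm n hnm)

lemma law_inter_le_exp_mul_law (θ u : S.param) (n : ℕ) (c : ℝ) {G : Set (Fin n → X)}
    (hG : MeasurableSet G) :
    S.law θ (pre n ⁻¹' (G ∩ {h | S.loglik n θ h - S.loglik n u h ≤ c})) ≤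
      ENNReal.ofReal (Real.exp c) * S.law u (pre n ⁻¹' G) := by
  have hmeas : MeasurableSet (G ∩ {h | S.loglik n θ h - S.loglik n u h ≤ c}) :=
    hG.inter (measurableSet_le (by fun_prop) measurable_const)
  have hle := exp_mul_withDensity_le (μ := S.ref n) (c := -c) (S.measurable_loglik n θ)
    (S.measurable_loglik n u) hmeas fun h hh => by linarith [hh.2.out]
  rw [← S.law_pre n θ hmeas, ← S.law_pre n u hmeas] at hle
  calc _ ≤ ENNReal.ofReal (Real.exp (- -c)) * _ := exp_neg_mul_of_exp_mul_le hle
    _ ≤ ENNReal.ofReal (Real.exp c) * S.law u (pre n ⁻¹' G) := by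
        rw [neg_neg]
        gcongr
        exact Set.inter_subset_left

end DataStream

section LowerBound

variable {K : ℕ} {X : Fin K → Type*} [∀ k, MeasurableSpace (X k)] {S : ∀ k, DataStream (X k)}
  {k : Fin K}

lemma jointLaw_inter_le_exp_mul_jointLaw (θ θ' : ∀ k, (S k).param) (n : ℕ) (c : ℝ)
    {s : Set (∀ k, ℕ → X k)} (hs : MeasurableSet[streamSigma X k n] s) :
    jointLaw S θ (s ∩ {ω | (S k).loglik n (θ k) (pre n (ω k)) -
      (S k).loglik n (θ' k) (pre n (ω k)) ≤ c}) ≤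
      ENNReal.ofReal (Real.exp c) * jointLaw S θ' s := by
  rw [streamSigma_eq_comap] at hs
  obtain ⟨G, hG, rfl⟩ := hs
  calc _ ≤ (S k).law (θ k) _ := jointLaw_eval_mem_le θ k
        (pre n ⁻¹' (G ∩ {h | (S k).loglik n (θ k) h - (S k).loglik n (θ' k) h ≤ c}))
    _ ≤ ENNReal.ofReal (Real.exp c) * (S k).law (θ' k) (pre n ⁻¹' G) :=
        DataStream.law_inter_le_exp_mul_law _ _ n c hG
    _ = _ := by
        rw [← (measurePreserving_eval_jointLaw θ' k).measure_preimage
          (measurable_pre n hG).nullMeasurableSet]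
        rfl

lemma jointLaw_time_le_le {T : (∀ k, ℕ → X k) → ℕ∞} {D : Set (∀ k, ℕ → X k)}
    (hTD : ∀ n : ℕ, MeasurableSet[streamSigma X k n] ({ω | T ω = n} ∩ D))
    (θ θ' : ∀ k, (S k).param) (m : ℕ) (c : ℝ) :
    jointLaw S θ {ω | T ω ≤ m} ≤ jointLaw S θ Dᶜ +
      (ENNReal.ofReal (Real.exp c) * jointLaw S θ' D +
        (S k).law (θ k) ((S k).ratioExceeds (θ k) (θ' k) m c)) :=
  (measure_time_le_le (fun n => (streamFiltration X k).le n _ (hTD n))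
    (fun n => jointLaw_inter_le_exp_mul_jointLaw θ θ' n c (hTD n)) m).trans <|
    add_le_add_right (add_le_add_right (jointLaw_eval_mem_le θ k _) _) _

lemma tendsto_abs_log_nhdsGT : Tendsto (fun α : ℝ => |Real.log α|) (𝓝[>] 0) atTop :=
  tendsto_abs_atBot_atTop.comp Real.tendsto_log_nhdsGT_zero

lemma tendsto_fst_levels : Tendsto Prod.fst levels (𝓝[>] 0) := tendsto_fst

lemma tendsto_snd_levels : Tendsto Prod.snd levels (𝓝[>] 0) := tendsto_snd

lemma tendsto_exp_floor_mul_ofReal {t C : ℝ} (ht : 0 < t) (hC : 0 < C) (htC : t * C < 1) :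
    Tendsto (fun α : ℝ => ENNReal.ofReal (Real.exp (⌊t * |Real.log α|⌋₊ * C)) * ENNReal.ofReal α)
      (𝓝[>] 0) (𝓝 0) := by
  have hlim : Tendsto (fun α : ℝ => ENNReal.ofReal (Real.exp (-((1 - t * C) * |Real.log α|))))
      (𝓝[>] 0) (𝓝 0) := by
    rw [← ENNReal.ofReal_zero]
    exact ENNReal.tendsto_ofReal (Real.tendsto_exp_neg_atTop_nhds_zero.comp
      (tendsto_abs_log_nhdsGT.const_mul_atTop (sub_pos.2 htC)))
  refine tendsto_of_tendsto_of_tendsto_of_le_of_le' tendsto_const_nhds hlim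
    (.of_forall fun _ => zero_le) ?_
  filter_upwards [Ioo_mem_nhdsGT one_pos] with α hα
  rw [← ENNReal.ofReal_mul (Real.exp_nonneg _)]
  refine ENNReal.ofReal_le_ofReal ?_
  have hfloor : (⌊t * |Real.log α|⌋₊ : ℝ) ≤ t * |Real.log α| := Nat.floor_le (by positivity)
  have hexp : Real.exp (-|Real.log α|) = α := by
    rw [abs_of_neg (Real.log_neg hα.1 hα.2), neg_neg, Real.exp_log hα.1]
  calc Real.exp (⌊t * |Real.log α|⌋₊ * C) * α
      = Real.exp (⌊t * |Real.log α|⌋₊ * C + -|Real.log α|) := by rw [Real.exp_add, hexp]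
    _ ≤ Real.exp (-((1 - t * C) * |Real.log α|)) := Real.exp_le_exp.2 (by nlinarith)

/-- The event `D` is read as a decision against `θ'`, so that `p.1` bounds the error probability
under `θ'` and `p.2` the one under `θ`. -/
lemma eventually_jointLaw_time_le_le {I : (S k).param → (S k).param → ℝ}
    (hI : (S k).RateBound I) (θ θ' : ∀ k, (S k).param) {t : ℝ} (ht : 0 < t)
    (htI : t * I (θ k) (θ' k) < 1) {ε : ℝ≥0∞} (hε : 0 < ε) :
    ∀ᶠ p : ℝ × ℝ in levels, ∀ (T : (∀ k, ℕ → X k) → ℕ∞) (D : Set (∀ k, ℕ → X k)),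
      (∀ n : ℕ, MeasurableSet[streamSigma X k n] ({ω | T ω = n} ∩ D)) →
      jointLaw S θ' D ≤ ENNReal.ofReal p.1 → jointLaw S θ Dᶜ ≤ ENNReal.ofReal p.2 →
      jointLaw S θ {ω | T ω ≤ ⌊t * |Real.log p.1|⌋₊} ≤ ε := by
  obtain ⟨C, hIC, hCt⟩ := exists_between ((lt_div_iff₀' ht).2 htI)
  have hC : 0 < C := (hI (θ k) (θ' k)).1.trans hIC
  have herr : Tendsto (fun p : ℝ × ℝ => ENNReal.ofReal p.2) levels (𝓝 0) := by
    rw [← ENNReal.ofReal_zero]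
    exact ENNReal.tendsto_ofReal (tendsto_snd_levels.mono_right nhdsWithin_le_nhds)
  have hchange := (tendsto_exp_floor_mul_ofReal ht hC ((lt_div_iff₀' ht).1 hCt)).comp
    tendsto_fst_levels
  have hratio := (DataStream.tendsto_law_ratioExceeds hI hIC).comp (tendsto_nat_floor_atTop.comp
    ((tendsto_abs_log_nhdsGT.comp tendsto_fst_levels).const_mul_atTop ht))
  have hsum := herr.add (hchange.add hratio)
  simp only [add_zero] at hsum
  filter_upwards [hsum.eventually_le_const hε] with p hp T D hTD hD hDc
  exact (jointLaw_time_le_le hTD θ θ' _ _).trans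
    ((add_le_add hDc (add_le_add (mul_le_mul_right hD _) le_rfl)).trans hp)

lemma eventually_le_lintegral_time {I : (S k).param → (S k).param → ℝ}
    (hI : (S k).RateBound I) (θ θ' : ∀ k, (S k).param) {s : ℝ} (hs : 0 < s)
    (hsI : s * I (θ k) (θ' k) < 1) :
    ∀ᶠ p : ℝ × ℝ in levels, ∀ (T : (∀ k, ℕ → X k) → ℕ∞) (D : Set (∀ k, ℕ → X k)), Measurable T →
      (∀ n : ℕ, MeasurableSet[streamSigma X k n] ({ω | T ω = n} ∩ D)) →
      jointLaw S θ' D ≤ ENNReal.ofReal p.1 → jointLaw S θ Dᶜ ≤ ENNReal.ofReal p.2 →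
      ENNReal.ofReal (s * |Real.log p.1|) ≤ ∫⁻ ω, (T ω : ℝ≥0∞) ∂jointLaw S θ := by
  obtain ⟨t, hst, htI⟩ := exists_between ((lt_div_iff₀ (hI (θ k) (θ' k)).1).2 hsI)
  have ht : 0 < t := hs.trans hst
  filter_upwards [eventually_jointLaw_time_le_le hI θ θ' ht ((lt_div_iff₀ (hI _ _).1).1 htI)
    (ENNReal.ofReal_pos.2 (sub_pos.2 ((div_lt_one ht).2 hst)))] with p hp T D hT hTD hD hDc
  exact ofReal_mul_le_lintegral_of_measure_le_floor_le hT hs hst (abs_nonneg _) (hp T D hTD hD hDc)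

end LowerBound

/-! ### Asymptotic equivalence -/

section Asymptotics

variable {ι : Type*} {l : Filter ι}

lemma tendsto_div_nhds_one_of_eventually_mul_le {f g : ι → ℝ≥0∞} (hg : ∀ᶠ x in l, g x ≠ 0)
    (hg' : ∀ᶠ x in l, g x ≠ ∞)
    (hlow : ∀ q : ℝ, 0 < q → q < 1 → ∀ᶠ x in l, ENNReal.ofReal q * g x ≤ f x)
    (hup : ∀ q : ℝ, 1 < q → ∀ᶠ x in l, f x ≤ ENNReal.ofReal q * g x) :
    Tendsto (fun x => f x / g x) l (𝓝 1) := by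
  refine tendsto_order.2 ⟨fun y hy => ?_, fun y hy => ?_⟩
  · obtain ⟨q, -, hyq, hq⟩ := ENNReal.lt_iff_exists_real_btwn.1 hy
    filter_upwards [hg, hg', hlow q (ENNReal.ofReal_pos.1 hyq.pos) (ENNReal.ofReal_lt_one.1 hq)]
      with x hx hx' hle
    exact hyq.trans_le ((ENNReal.le_div_iff_mul_le (.inl hx) (.inl hx')).2 hle)
  · obtain ⟨q, -, hq, hqy⟩ := ENNReal.lt_iff_exists_real_btwn.1 hy
    filter_upwards [hup q (ENNReal.one_lt_ofReal.1 hq)] with x hle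
    exact (ENNReal.div_le_of_le_mul hle).trans_lt hqy

lemma tendsto_div_of_tendsto_div {f g h : ι → ℝ≥0∞} (hh : ∀ᶠ x in l, h x ≠ 0)
    (hh' : ∀ᶠ x in l, h x ≠ ∞) (hf : Tendsto (fun x => f x / h x) l (𝓝 1))
    (hg : Tendsto (fun x => g x / h x) l (𝓝 1)) : Tendsto (fun x => f x / g x) l (𝓝 1) := by
  have hdiv := ENNReal.Tendsto.div hf (.inl one_ne_zero) hg (.inl ENNReal.one_ne_top)
  rw [div_one] at hdiv
  refine hdiv.congr' ?_
  filter_upwards [hh, hh'] with x hx hx'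
  simp only [div_eq_mul_inv (f x), div_eq_mul_inv (g x)]
  exact ENNReal.mul_div_mul_right _ _ (ENNReal.inv_ne_zero.2 hx') (ENNReal.inv_ne_top.2 hx)

lemma eventually_ofReal_div_add_le {a L : ι → ℝ} (hL : Tendsto L l atTop)
    (ha : Tendsto (fun x => a x / L x) l (𝓝 1)) {s t : ℝ} (ht : 0 < t) (hst : 1 < s * t)
    {c : ℝ≥0∞} (hc : c < ∞) :
    ∀ᶠ x in l, ENNReal.ofReal (a x / t) + c ≤ ENNReal.ofReal (s * L x) := by
  have hlim : Tendsto (fun x => a x / L x / t + c.toReal / L x) l (𝓝 (1 / t)) := by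
    simpa using (ha.div_const t).add (hL.const_div_atTop c.toReal)
  filter_upwards [hlim.eventually_lt_const ((div_lt_iff₀ ht).2 hst), hL.eventually_gt_atTop 0,
    ha.eventually_const_lt one_pos] with x hlt hLx hax
  have hax' : 0 ≤ a x / t := div_nonneg ((div_pos_iff_of_pos_right hLx).1 hax).le ht.le
  rw [div_right_comm, ← add_div, div_lt_iff₀ hLx] at hlt
  rw [← ENNReal.ofReal_toReal hc.ne, ← ENNReal.ofReal_add hax' ENNReal.toReal_nonneg]
  exact ENNReal.ofReal_le_ofReal hlt.le

lemma asympEq_and_asympEq_of_bounds {U O : ℝ → ℝ → ℝ≥0∞} {L : ℝ → ℝ → ℝ} {r : ℝ} (hr : 0 < r)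
    (hL : Tendsto (fun p : ℝ × ℝ => L p.1 p.2) levels atTop)
    (hOU : ∀ᶠ p : ℝ × ℝ in levels, O p.1 p.2 ≤ U p.1 p.2)
    (hlow : ∀ s, 0 < s → s * r < 1 →
      ∀ᶠ p : ℝ × ℝ in levels, ENNReal.ofReal (s * L p.1 p.2) ≤ O p.1 p.2)
    (hup : ∀ s, 1 < s * r →
      ∀ᶠ p : ℝ × ℝ in levels, U p.1 p.2 ≤ ENNReal.ofReal (s * L p.1 p.2)) :
    AsympEq U O ∧ AsympEq O (fun α β => ENNReal.ofReal (L α β / r)) := by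
  have hne : ∀ᶠ p : ℝ × ℝ in levels, ENNReal.ofReal (L p.1 p.2 / r) ≠ 0 := by
    filter_upwards [hL.eventually_gt_atTop 0] with p hp
    exact (ENNReal.ofReal_pos.2 (div_pos hp hr)).ne'
  have hne' : ∀ᶠ p : ℝ × ℝ in levels, ENNReal.ofReal (L p.1 p.2 / r) ≠ ∞ :=
    .of_forall fun _ => ENNReal.ofReal_ne_top
  have hmul {q : ℝ} (hq : 0 ≤ q) (p : ℝ × ℝ) :
      ENNReal.ofReal q * ENNReal.ofReal (L p.1 p.2 / r) =
        ENNReal.ofReal (q / r * L p.1 p.2) := by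
    rw [← ENNReal.ofReal_mul hq, mul_div_assoc', div_mul_eq_mul_div]
  have hOlow (q : ℝ) (hq : 0 < q) (hq1 : q < 1) : ∀ᶠ p : ℝ × ℝ in levels,
      ENNReal.ofReal q * ENNReal.ofReal (L p.1 p.2 / r) ≤ O p.1 p.2 := by
    simpa only [hmul hq.le] using hlow (q / r) (by positivity) (by rwa [div_mul_cancel₀ q hr.ne'])
  have hUup (q : ℝ) (hq1 : 1 < q) : ∀ᶠ p : ℝ × ℝ in levels,
      U p.1 p.2 ≤ ENNReal.ofReal q * ENNReal.ofReal (L p.1 p.2 / r) := by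
    simpa only [hmul (one_pos.trans hq1).le] using
      hup (q / r) (by rwa [div_mul_cancel₀ q hr.ne'])
  have hO := tendsto_div_nhds_one_of_eventually_mul_le hne hne' hOlow
    fun q hq => EventuallyLE.trans hOU (hUup q hq)
  have hU := tendsto_div_nhds_one_of_eventually_mul_le hne hne'
    (fun q hq hq1 => EventuallyLE.trans (hOlow q hq hq1) hOU) hUup
  exact ⟨tendsto_div_of_tendsto_div hne hne' hU hO, hO⟩

lemma tendsto_abs_log_add_div (M : ℝ) :
    Tendsto (fun α : ℝ => (|Real.log α| + M) / |Real.log α|) (𝓝[>] 0) (𝓝 1) := by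
  have hlim := (tendsto_abs_log_nhdsGT.const_div_atTop M).const_add 1
  rw [add_zero] at hlim
  refine hlim.congr' ?_
  filter_upwards [tendsto_abs_log_nhdsGT.eventually_gt_atTop 0] with α hα
  rw [add_div, div_self hα.ne']

lemma eventually_levels_mem_Ioo :
    ∀ᶠ p : ℝ × ℝ in levels, p.1 ∈ Set.Ioo (0 : ℝ) 1 ∧ p.2 ∈ Set.Ioo (0 : ℝ) 1 :=
  (tendsto_fst_levels.eventually (Ioo_mem_nhdsGT one_pos)).and
    (tendsto_snd_levels.eventually (Ioo_mem_nhdsGT one_pos))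

end Asymptotics

/-! ### Optimality of the parallel test -/

section Optimality

variable {K : ℕ} {X : Fin K → Type*} [∀ k, MeasurableSpace (X k)] {S : ∀ k, DataStream (X k)}
  {E : ∀ k, Estimator (S k)} {I : ∀ k, (S k).param → (S k).param → ℝ}
  {prior : Set (Finset (Fin K))} {A : Finset (Fin K)} {θ : ∀ k, (S k).param} {k : Fin K}
  {α β : ℝ} {χ : Procedure X}

lemma consistent_eq_pi (A : Finset (Fin K)) :
    consistent S A = Set.univ.pi fun k => if k ∈ A then (S k).alt else (S k).null := by
  ext θ
  simp only [consistent, Set.mem_ofPred_eq, Set.mem_univ_pi, ← forall_and]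
  refine forall_congr' fun k => ?_
  by_cases hk : k ∈ A <;> simp [hk]

lemma eval_image_consistent (A : Finset (Fin K)) (k : Fin K) :
    Function.eval k '' consistent S A = if k ∈ A then (S k).alt else (S k).null := by
  rw [consistent_eq_pi]
  refine Set.eval_image_univ_pi (Set.univ_pi_nonempty_iff.2 fun k => ?_)
  split_ifs
  exacts [(S k).alt_nonempty, (S k).null_nonempty]

lemma jointLaw_dec_le_of_mem_controlled (hχ : χ ∈ controlled S prior α β) (hA : A ∈ prior)
    (hθ : θ ∈ consistent S A) (hk : k ∉ A) :
    jointLaw S θ {ω | χ.dec k ω} ≤ ENNReal.ofReal α :=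
  calc _ ≤ jointLaw S θ {ω | ∃ j, j ∉ A ∧ χ.dec j ω} := measure_mono fun _ hω => ⟨k, hk, hω⟩
    _ ≤ _ := iSup₂_le_iff.1 (hχ.2 A hA).2.1 θ hθ

lemma jointLaw_not_dec_le_of_mem_controlled (hχ : χ ∈ controlled S prior α β) (hA : A ∈ prior)
    (hθ : θ ∈ consistent S A) (hk : k ∈ A) :
    jointLaw S θ {ω | ¬χ.dec k ω} ≤ ENNReal.ofReal β :=
  calc _ ≤ jointLaw S θ {ω | ∃ i, i ∈ A ∧ ¬χ.dec i ω} := measure_mono fun _ hω => ⟨k, hk, hω⟩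
    _ ≤ _ := iSup₂_le_iff.1 (hχ.2 A hA).2.2 θ hθ

lemma exists_mul_lt_one_of_mul_iInf_lt_one {ι : Type*} [Nonempty ι] {f : ι → ℝ} {s : ℝ}
    (hs : 0 < s) (h : s * ⨅ u, f u < 1) : ∃ u, s * f u < 1 := by
  obtain ⟨u, hu⟩ := exists_lt_of_ciInf_lt ((lt_div_iff₀' hs).2 h)
  exact ⟨u, (lt_div_iff₀' hs).1 hu⟩

lemma eventually_le_optTime_of_mem (hrate : (S k).RateBound (I k))
    (hprior : ∃ B ∈ prior, k ∉ B) (hA : A ∈ prior) (hθ : θ ∈ consistent S A) (hk : k ∈ A) {s : ℝ}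
    (hs : 0 < s) (hsI : s * (S k).rateNull (I k) (θ k) < 1) :
    ∀ᶠ p : ℝ × ℝ in levels,
      ENNReal.ofReal (s * |Real.log p.1|) ≤ optTime S prior θ k p.1 p.2 := by
  have : Nonempty (S k).null := (S k).null_nonempty.to_subtype
  obtain ⟨⟨u, hu⟩, hsu⟩ := exists_mul_lt_one_of_mul_iInf_lt_one hs hsI
  obtain ⟨B, hB, hkB⟩ := hprior
  obtain ⟨θ', hθ', rfl⟩ : u ∈ Function.eval k '' consistent S B := by
    rwa [eval_image_consistent, if_neg hkB]
  filter_upwards [eventually_le_lintegral_time hrate θ θ' hs hsu] with p hp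
  refine le_iInf₂ fun χ hχ => hp (χ.time k) {ω | χ.dec k ω} (hχ.1.2.measurable_time k)
    (fun n => ((hχ.1.2 k).2.2 n).2.1) ?_ ?_
  · exact jointLaw_dec_le_of_mem_controlled hχ.2 hB hθ' hkB
  · exact jointLaw_not_dec_le_of_mem_controlled hχ.2 hA hθ hk

lemma eventually_le_optTime_of_notMem (hrate : (S k).RateBound (I k))
    (hprior : ∃ B ∈ prior, k ∈ B) (hA : A ∈ prior) (hθ : θ ∈ consistent S A) (hk : k ∉ A) {s : ℝ}
    (hs : 0 < s) (hsI : s * (S k).rateAlt (I k) (θ k) < 1) :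
    ∀ᶠ p : ℝ × ℝ in levels,
      ENNReal.ofReal (s * |Real.log p.2|) ≤ optTime S prior θ k p.1 p.2 := by
  have : Nonempty (S k).alt := (S k).alt_nonempty.to_subtype
  obtain ⟨⟨u, hu⟩, hsu⟩ := exists_mul_lt_one_of_mul_iInf_lt_one hs hsI
  obtain ⟨B, hB, hkB⟩ := hprior
  obtain ⟨θ', hθ', rfl⟩ : u ∈ Function.eval k '' consistent S B := by
    rwa [eval_image_consistent, if_pos hkB]
  filter_upwards [(tendsto_snd_levels.prodMk tendsto_fst_levels).eventually
    (eventually_le_lintegral_time hrate θ θ' hs hsu)] with p hp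
  refine le_iInf₂ fun χ hχ => hp (χ.time k) {ω | ¬χ.dec k ω} (hχ.1.2.measurable_time k)
    (fun n => ((hχ.1.2 k).2.2 n).2.2) ?_ ?_
  · exact jointLaw_not_dec_le_of_mem_controlled hχ.2 hB hθ' hkB
  · simpa only [Set.compl_ofPred, not_not] using
      jointLaw_dec_le_of_mem_controlled hχ.2 hA hθ hk

lemma sprt_mem_controlled (hsep : ∀ k, (S k).Separated (I k))
    (hconv : ∀ k, (S k).CompleteConvergence (E k) (I k)) {M N : ℝ}
    (hα : α ∈ Set.Ioo 0 1) (hβ : β ∈ Set.Ioo 0 1) (ha : 0 < |Real.log α| + M)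
    (hb : 0 < |Real.log β| + N) (hM : ∀ A ∈ prior, Real.log Aᶜ.card ≤ M)
    (hN : ∀ A ∈ prior, Real.log A.card ≤ N) :
    sprt S E (|Real.log α| + M) (|Real.log β| + N) ∈ controlled S prior α β := by
  refine ⟨(sprt_mem_decentralized S E _ _).1, fun A hA => ?_⟩
  have htop (θ) (hθ : θ ∈ consistent S A) := ae_sprt_time_lt_top hsep hconv hθ ha hb
  refine ⟨htop, iSup₂_le fun θ hθ => ?_, iSup₂_le fun θ hθ => ?_⟩
  · simp only [← Finset.mem_compl]
    exact measure_exists_mem_le_of_log_card_le hα (hM A hA) fun j hj =>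
      jointLaw_sprt_dec_le (hθ.2 j (Finset.mem_compl.1 hj)) ha
  · exact measure_exists_mem_le_of_log_card_le hβ (hN A hA) fun i hi =>
      jointLaw_not_sprt_dec_le (hθ.1 i hi) hb (htop θ hθ i)

lemma suitableThresholds_abs_log_add_iSup (hsep : ∀ k, (S k).Separated (I k))
    (hconv : ∀ k, (S k).CompleteConvergence (E k) (I k)) :
    SuitableThresholds S E prior
      (fun α _ => |Real.log α| + ⨆ A : prior, Real.log ((A : Finset (Fin K))ᶜ.card : ℝ))
      (fun _ β => |Real.log β| + ⨆ A : prior, Real.log ((A : Finset (Fin K)).card : ℝ)) := by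
  have hpos {r : ℝ} (hr : r ∈ Set.Ioo 0 1) (f : prior → Finset (Fin K)) :
      0 < |Real.log r| + ⨆ A, Real.log (f A).card :=
    add_pos_of_pos_of_nonneg (abs_pos.2 (Real.log_neg hr.1 hr.2).ne)
      (Real.iSup_nonneg fun _ => Real.log_natCast_nonneg _)
  have hle (f : prior → Finset (Fin K)) (A : prior) :
      Real.log (f A).card ≤ ⨆ A, Real.log (f A).card :=
    le_ciSup (f := fun A => Real.log (f A).card) (Set.finite_range _).bddAbove A
  refine ⟨fun α hα β hβ => ⟨hpos hα _, hpos hβ _, ?_⟩,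
    (tendsto_abs_log_add_div _).comp tendsto_fst_levels,
    (tendsto_abs_log_add_div _).comp tendsto_snd_levels⟩
  exact sprt_mem_controlled hsep hconv hα hβ (hpos hα _) (hpos hβ _)
    (fun A hA => hle (fun A => (A : Finset (Fin K))ᶜ) ⟨A, hA⟩) fun A hA => hle (·) ⟨A, hA⟩

variable {a b : ℝ → ℝ → ℝ}

lemma eventually_optTime_le_expTime_sprt (hab : SuitableThresholds S E prior a b)
    (θ : ∀ k, (S k).param) (k : Fin K) :
    ∀ᶠ p : ℝ × ℝ in levels, optTime S prior θ k p.1 p.2 ≤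
      expTime S θ (sprt S E (a p.1 p.2) (b p.1 p.2)) k := by
  filter_upwards [eventually_levels_mem_Ioo] with p hp
  exact iInf₂_le _ ⟨sprt_mem_decentralized S E _ _, (hab.1 p.1 hp.1 p.2 hp.2).2.2⟩

lemma eventually_expTime_sprt_le_of_mem_alt (hconv : (S k).CompleteConvergence (E k) (I k))
    (hab : SuitableThresholds S E prior a b) (hθ : θ k ∈ (S k).alt)
    (hI : 0 < (S k).rateNull (I k) (θ k)) {s : ℝ} (hs : 1 < s * (S k).rateNull (I k) (θ k)) :
    ∀ᶠ p : ℝ × ℝ in levels, expTime S θ (sprt S E (a p.1 p.2) (b p.1 p.2)) k ≤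
      ENNReal.ofReal (s * |Real.log p.1|) := by
  have hs0 : 0 < s := pos_of_mul_pos_left (one_pos.trans hs) hI.le
  obtain ⟨t, hst, htI⟩ := exists_between ((div_lt_iff₀' hs0).2 hs)
  have ht : 0 < t := (one_div_pos.2 hs0).trans hst
  obtain ⟨c, hc, hle⟩ := exists_expTime_sprt_le_of_mem_alt (E := E) hconv hθ ht htI
  filter_upwards [eventually_levels_mem_Ioo, eventually_ofReal_div_add_le
    (tendsto_abs_log_nhdsGT.comp tendsto_fst_levels) hab.2.1 ht ((div_lt_iff₀' hs0).1 hst) hc]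
    with p hp hadd
  exact (hle _ _ (hab.1 p.1 hp.1 p.2 hp.2).1).trans hadd

lemma eventually_expTime_sprt_le_of_mem_null (hconv : (S k).CompleteConvergence (E k) (I k))
    (hab : SuitableThresholds S E prior a b) (hθ : θ k ∈ (S k).null)
    (hI : 0 < (S k).rateAlt (I k) (θ k)) {s : ℝ} (hs : 1 < s * (S k).rateAlt (I k) (θ k)) :
    ∀ᶠ p : ℝ × ℝ in levels, expTime S θ (sprt S E (a p.1 p.2) (b p.1 p.2)) k ≤
      ENNReal.ofReal (s * |Real.log p.2|) := by
  have hs0 : 0 < s := pos_of_mul_pos_left (one_pos.trans hs) hI.le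
  obtain ⟨t, hst, htI⟩ := exists_between ((div_lt_iff₀' hs0).2 hs)
  have ht : 0 < t := (one_div_pos.2 hs0).trans hst
  obtain ⟨c, hc, hle⟩ := exists_expTime_sprt_le_of_mem_null (E := E) hconv hθ ht htI
  filter_upwards [eventually_levels_mem_Ioo, eventually_ofReal_div_add_le
    (tendsto_abs_log_nhdsGT.comp tendsto_snd_levels) hab.2.2 ht ((div_lt_iff₀' hs0).1 hst) hc]
    with p hp hadd
  exact (hle _ _ (hab.1 p.1 hp.1 p.2 hp.2).2.1).trans hadd

end Optimality

end SeqTest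

theorem theorem7p2 {K : ℕ} {X : Fin K → Type*} [∀ k, MeasurableSpace (X k)]
    (S : ∀ k, SeqTest.DataStream (X k)) (E : ∀ k, SeqTest.Estimator (S k))
    (I : ∀ k, (S k).param → (S k).param → ℝ)
    (hrate : ∀ k, (S k).RateBound (I k))
    (hsep : ∀ k, (S k).Separated (I k))
    (hconv : ∀ k, (S k).CompleteConvergence (E k) (I k))
    (prior : Set (Finset (Fin K)))
    (hprior : ∀ k, ∃ A ∈ prior, ∃ B ∈ prior, k ∈ A ∧ k ∉ B) :
    SeqTest.SuitableThresholds S E prior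
      (fun α _ => |Real.log α| + ⨆ A : prior, Real.log ((A : Finset (Fin K))ᶜ.card : ℝ))
      (fun _ β => |Real.log β| + ⨆ A : prior, Real.log ((A : Finset (Fin K)).card : ℝ)) ∧
    ∀ a b : ℝ → ℝ → ℝ, SeqTest.SuitableThresholds S E prior a b →
      ∀ A ∈ prior, ∀ θ ∈ SeqTest.consistent S A,
        (∀ i ∈ A,
          SeqTest.AsympEq
            (fun α β => SeqTest.expTime S θ (SeqTest.sprt S E (a α β) (b α β)) i)
            (SeqTest.optTime S prior θ i) ∧
          SeqTest.AsympEq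
            (SeqTest.optTime S prior θ i)
            (fun α _ => ENNReal.ofReal (|Real.log α| / (S i).rateNull (I i) (θ i)))) ∧
        (∀ j ∉ A,
          SeqTest.AsympEq
            (fun α β => SeqTest.expTime S θ (SeqTest.sprt S E (a α β) (b α β)) j)
            (SeqTest.optTime S prior θ j) ∧
          SeqTest.AsympEq
            (SeqTest.optTime S prior θ j)
            (fun _ β => ENNReal.ofReal (|Real.log β| / (S j).rateAlt (I j) (θ j)))) := by
  refine ⟨SeqTest.suitableThresholds_abs_log_add_iSup hsep hconv,
    fun a b hab A hA θ hθ => ⟨fun i hi => ?_, fun j hj => ?_⟩⟩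
  · have hI := (hsep i).1 (θ i) (hθ.1 i hi)
    obtain ⟨-, -, B, hB, -, hiB⟩ := hprior i
    exact SeqTest.asympEq_and_asympEq_of_bounds hI
      (SeqTest.tendsto_abs_log_nhdsGT.comp SeqTest.tendsto_fst_levels)
      (SeqTest.eventually_optTime_le_expTime_sprt hab θ i)
      (fun _ => SeqTest.eventually_le_optTime_of_mem (hrate i) ⟨B, hB, hiB⟩ hA hθ hi)
      (fun _ => SeqTest.eventually_expTime_sprt_le_of_mem_alt (hconv i) hab (hθ.1 i hi) hI)
  · have hJ := (hsep j).2 (θ j) (hθ.2 j hj)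
    obtain ⟨B, hB, -, -, hjB, -⟩ := hprior j
    exact SeqTest.asympEq_and_asympEq_of_bounds hJ
      (SeqTest.tendsto_abs_log_nhdsGT.comp SeqTest.tendsto_snd_levels)
      (SeqTest.eventually_optTime_le_expTime_sprt hab θ j)
      (fun _ => SeqTest.eventually_le_optTime_of_notMem (hrate j) ⟨B, hB, hjB⟩ hA hθ hj)
      (fun _ => SeqTest.eventually_expTime_sprt_le_of_mem_null (hconv j) hab (hθ.2 j hj) hJ)
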